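/- Let $\Sigma=\{0,1\}$ and order $\Sigma^*$ by length first and lexicographically among strings of equal length ($\epsilon<0<1<00<01<\cdots$). For $A\subseteq\Sigma^*$ and $x\in\Sigma^*$ let $\mathrm{rank}_A(x)=|\{z\in A : z\le x\}|$. The set $A$ is strong-P-rankable if the function $x\mapsto \mathrm{rank}_A(x)$ on $\Sigma^*$ (values written in binary) is computable in polynomial time. It is semistrong-P-rankable if some polynomial-time computable function on $\Sigma^*$ maps each $x\in A$ to $\mathrm{rank}_A(x)$ and each $x\notin A$ to a special value meaning "not in the set". It is nongappy if there is a polynomial $p$ such that for every $n\in\mathbb{N}$ there is some $y\in A$ with $n\le |y|\le p(n)$. Here $\mathrm{UP}$ is the class of sets $B\subseteq\Sigma^*$ for which there are a polynomial $q$ and a polynomial-time decidable relation $V\subseteq\Sigma^*\times\Sigma^*$ such that each $x\in B$ has exactly one, and each $x\notin B$ has no, certificate $w$ with $|w|\le q(|x|)$ and $V(x,w)$ (equivalently, $B$ is accepted by a nondeterministic polynomial-time machine that has at most one accepting path on every input), and $\mathrm{coUP}=\{B\subseteq\Sigma^* : \Sigma^*\setminus B\in\mathrm{UP}\}$. **Theorem.**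 If $\mathrm{P}=\mathrm{UP}\cap\mathrm{coUP}$, then every nongappy semistrong-P-rankable set $A\subseteq\Sigma^*$ is strong-P-rankable. -/

import Mathlib

namespace Ranking

/-- `Σ*` for `Σ = {0, 1}`, with `false` for `0` and `true` for `1`. -/
abbrev Word : Type := List Bool

/-- `f` is computed by a (deterministic, multi-stack) Turing machine that halts within `p (n)`
steps, for some polynomial `p`, where `n` is the length of the encoded input. Arguments are encoded
by `ea`, values by `eb`. -/
def PolyTime {α β αΓ βΓ : Type} (ea : α → List αΓ) (eb : β → List βΓ) (f : α → β) : Prop :=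
  Nonempty (Turing.TM2ComputableInPolyTime ea eb f)

/-- A pair of words as one word over a four-letter alphabet: the first component written with the
letters `inl 0`, `inl 1`, followed by the second one written with `inr 0`, `inr 1`. -/
def encodePair (q : Word × Word) : List (Bool ⊕ Bool) :=
  q.1.map Sum.inl ++ q.2.map Sum.inr

/-- The values of a semistrong ranking function as words: `none` ("not in the set") is the empty
word, and the number `n` is its binary representation preceded by the digit `1`. -/
def encodeOptionNat : Option ℕ → Word
  | none => []
  | some n => true :: Computability.encodeNat n

/-- The class `P`. -/
def P : Set (Set Word) :=
  {A | ∃ f : Word → Bool, PolyTime id Computability.encodeBool f ∧ ∀ x, x ∈ A ↔ f x = true}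

/-- The class `UP`: members have exactly one polynomially bounded certificate, nonmembers have none,
for a relation that is decided in deterministic polynomial time. -/
def UP : Set (Set Word) :=
  {A | ∃ (V : Word × Word → Bool) (p : Polynomial ℕ),
    PolyTime encodePair Computability.encodeBool V ∧
    ∀ x, (x ∈ A → ∃! w : Word, w.length ≤ p.eval x.length ∧ V (x, w) = true) ∧
      (x ∉ A → ¬ ∃ w : Word, w.length ≤ p.eval x.length ∧ V (x, w) = true)}

/-- The class `coUP` of the complements of the sets in `UP`. -/
def coUP : Set (Set Word) := {A | Aᶜ ∈ UP}

/-- `z ≤ y`: shorter words come first, words of the same length are ordered lexicographically, so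
that the enumeration of all words is `ε, 0, 1, 00, 01, …`. -/
def WordLE (z y : Word) : Prop := z = y ∨ List.Shortlex (· < ·) z y

/-- The number of elements of `A` that are at most `y`. -/
noncomputable def rank (A : Set Word) (y : Word) : ℕ := {z | WordLE z y ∧ z ∈ A}.ncard

/-- `f` gives the rank on `A` and signals "not in the set" (by `none`) off `A`. -/
def IsSemistrongRankingFunction (A : Set Word) (f : Word → Option ℕ) : Prop :=
  ∀ x, (x ∈ A → f x = some (rank A x)) ∧ (x ∉ A → f x = none)

/-- `f` gives the rank on all words. -/
def IsStrongRankingFunction (A : Set Word) (f : Word → ℕ) : Prop :=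
  ∀ x, f x = rank A x

def SemistrongPRankable (A : Set Word) : Prop :=
  ∃ f : Word → Option ℕ, PolyTime id encodeOptionNat f ∧ IsSemistrongRankingFunction A f

/-- Ranks are written in binary. -/
def StrongPRankable (A : Set Word) : Prop :=
  ∃ f : Word → ℕ, PolyTime id Computability.encodeNat f ∧ IsStrongRankingFunction A f

def Nongappy (A : Set Word) : Prop :=
  ∃ p : Polynomial ℕ, ∀ n : ℕ, ∃ y ∈ A, n ≤ y.length ∧ y.length ≤ p.eval n

end Ranking

/-! Fix `x`, let `z` be the last element of `A` up to `x` (there may be none) and `y` the first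
element after `x`. Nongappiness bounds the length of `y` polynomially. The pair is easy to verify
without knowing the rank of `x`: the semistrong ranking function confirms membership of both words
and yields their ranks, and `z ≤ x < y` with consecutive ranks leaves no room for further elements
between them. Ranks are injective on `A`, so the pair is the only valid certificate, and it reveals
the rank of `x`, namely that of `z`, or `0` if there is no `z`.

Hence "digit `i` of the rank of `x` is `t`" lies in UP for both values of `t` (`digitSet_mem_UP`).
The two sets are complementary, so each lies in UP ∩ coUP, which is P by hypothesis. The rank has at
most `|x| + 1` digits, and querying them one by one computes it
(`strongPRankable_of_digitSet_mem_P`). The certificates rest on `exists_isBracket`,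
`IsBracket.unique` and `checkBracket_iff`.

Polynomial time means an actual multi-stack machine here. Programs are therefore assembled from
fragments (`Realizable`), giving closure under composition, pairing, bounded iteration and
sequential transducers; all later algorithms use only these. -/

namespace Ranking

open Turing Function

/-! ### Counting steps -/

/-- `StepsIn f n a b`: iterating the partial function `f` leads from `a` to `b` in `n` steps. -/
inductive StepsIn {C : Type*} (f : C → Option C) : ℕ → C → C → Prop
  | refl (a : C) : StepsIn f 0 a a
  | head {n : ℕ} {a b c : C} : f a = some b → StepsIn f n b c → StepsIn f (n + 1) a c

namespace StepsIn

variable {C : Type*} {f : C → Option C}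

theorem trans {m n : ℕ} {a b c : C} (h₁ : StepsIn f m a b) (h₂ : StepsIn f n b c) :
    StepsIn f (m + n) a c := by
  induction h₁ with
  | refl a => simpa using h₂
  | head h _ ih => rw [Nat.add_right_comm]; exact .head h (ih h₂)

theorem single {a b : C} (h : f a = some b) : StepsIn f 1 a b := .head h (.refl b)

theorem iterate_bind_none (n : ℕ) : (flip bind f)^[n] none = none := by
  induction n with
  | zero => rfl
  | succ n ih => rw [iterate_succ_apply]; exact ih

/-- The field `evals_in_steps` of a machine's computation is phrased with this iterate. -/
theorem iff_iterate {n : ℕ} {a b : C} :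
    StepsIn f n a b ↔ (flip bind f)^[n] (some a) = some b := by
  constructor
  · intro h
    induction h with
    | refl a => rfl
    | head h _ ih => rw [iterate_succ_apply]; simpa [flip, h] using ih
  · induction n generalizing a with
    | zero => intro h; cases h; exact .refl _
    | succ n ih =>
      intro h
      rw [iterate_succ_apply] at h
      cases hf : f a with
      | none =>
        simp only [flip, Option.bind_eq_bind, Option.bind_some, hf] at h
        have := iterate_bind_none (f := f) n
        simp only [Option.bind_eq_bind] at this
        rw [this] at h
        cases h
      | some c => exact .head hf (ih (by simpa [flip, hf] using h))

end StepsIn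

/-! ### Fragments of multi-stack programs -/

/-- A finite control with a finite internal memory working on the stacks `K`. -/
structure Fragment {K : Type} (Γ : K → Type) where
  Λ : Type
  [finΛ : Fintype Λ]
  σ : Type
  [finσ : Fintype σ]
  main : Λ
  init : σ
  code : Λ → TM2.Stmt Γ Λ σ

attribute [instance] Fragment.finΛ Fragment.finσ

/-- The contents of all stacks. -/
abbrev Store {K : Type} (Γ : K → Type) : Type := ∀ k, List (Γ k)

/-! ### Sequential composition and loops -/

section Control

variable {K : Type} {Γ : K → Type}

/-- A transition of `R` followed by a transition of `R'`. -/
def Seq (R R' : Store Γ → Store Γ → ℕ → Prop) (s t : Store Γ) (n : ℕ) : Prop :=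
  ∃ u a b, R s u a ∧ R' u t b ∧ a + b = n

theorem Seq.intro {R R' : Store Γ → Store Γ → ℕ → Prop} {s u t : Store Γ} {a b : ℕ}
    (h : R s u a) (h' : R' u t b) : Seq R R' s t (a + b) :=
  ⟨u, a, b, h, h', rfl⟩

variable [DecidableEq K]

/-- A relation between initial stores, final stores and running times is realizable if some
fragment performs all the transitions in it. -/
def Realizable (R : Store Γ → Store Γ → ℕ → Prop) : Prop :=
  ∃ F : Fragment Γ, ∀ s t n, R s t n →
    ∃ j ≤ n, StepsIn (TM2.step F.code) j ⟨some F.main, F.init, s⟩ ⟨none, F.init, t⟩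

theorem Realizable.mono {R R' : Store Γ → Store Γ → ℕ → Prop} (h : Realizable R)
    (hR : ∀ s t n, R' s t n → ∃ m ≤ n, R s t m) : Realizable R' := by
  obtain ⟨F, hF⟩ := h
  refine ⟨F, fun s t n h => ?_⟩
  obtain ⟨m, hm, h⟩ := hR s t n h
  obtain ⟨j, hj, h⟩ := hF s t m h
  exact ⟨j, hj.trans hm, h⟩

section Embed

variable {Λ Λ' σ σ' : Type}

/-- The statement `q` as a part of a larger control: `fl` embeds the labels, `ex` is where to go
instead of halting, `pr` and `up` read and write the memory of `q` in the larger memory. -/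
def embedStmt (fl : Λ → Λ') (ex : Option Λ') (pr : σ' → σ) (up : σ' → σ → σ') :
    TM2.Stmt Γ Λ σ → TM2.Stmt Γ Λ' σ'
  | .push k f q => .push k (fun v => f (pr v)) (embedStmt fl ex pr up q)
  | .peek k f q => .peek k (fun v o => up v (f (pr v) o)) (embedStmt fl ex pr up q)
  | .pop k f q => .pop k (fun v o => up v (f (pr v) o)) (embedStmt fl ex pr up q)
  | .load f q => .load (fun v => up v (f (pr v))) (embedStmt fl ex pr up q)
  | .branch f q q' => .branch (fun v => f (pr v)) (embedStmt fl ex pr up q)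
      (embedStmt fl ex pr up q')
  | .goto f => .goto fun v => fl (f (pr v))
  | .halt => ex.elim .halt fun l => .goto fun _ => l

variable {fl : Λ → Λ'} {ex : Option Λ'} {pr : σ' → σ} {up : σ' → σ → σ'}

/-- `hpr` and `hup` are the put-get and put-put laws of a lens: under them `q` acts on its part of
the larger memory and leaves the rest of `w` alone. -/
theorem stepAux_embedStmt (hpr : ∀ w v, pr (up w v) = v) (hup : ∀ w v u, up (up w v) u = up w u)
    (q : TM2.Stmt Γ Λ σ) (w : σ') (v : σ) (s : Store Γ) :
    TM2.stepAux (embedStmt fl ex pr up q) (up w v) s =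
      ⟨(TM2.stepAux q v s).l.elim ex (some ∘ fl), up w (TM2.stepAux q v s).var,
        (TM2.stepAux q v s).stk⟩ := by
  induction q generalizing v s with
  | push k f q ih => simp only [embedStmt, TM2.stepAux, hpr, ih]
  | peek k f q ih => simp only [embedStmt, TM2.stepAux, hpr, hup, ih]
  | pop k f q ih => simp only [embedStmt, TM2.stepAux, hpr, hup, ih]
  | load f q ih => simp only [embedStmt, TM2.stepAux, hpr, hup, ih]
  | branch f q q' ih ih' =>
    simp only [embedStmt, TM2.stepAux, hpr, ih, ih']
    cases f v <;> rfl
  | goto f => simp [embedStmt, TM2.stepAux, hpr]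
  | halt => cases ex <;> simp [embedStmt, TM2.stepAux]

theorem StepsIn.embed {M : Λ → TM2.Stmt Γ Λ σ} {M' : Λ' → TM2.Stmt Γ Λ' σ'}
    (hpr : ∀ w v, pr (up w v) = v) (hup : ∀ w v u, up (up w v) u = up w u)
    (hM : ∀ l, M' (fl l) = embedStmt fl ex pr up (M l)) {n : ℕ} {c d : TM2.Cfg Γ Λ σ}
    (h : StepsIn (TM2.step M) n c d) (w : σ') :
    StepsIn (TM2.step M') n ⟨c.l.elim ex (some ∘ fl), up w c.var, c.stk⟩
      ⟨d.l.elim ex (some ∘ fl), up w d.var, d.stk⟩ := by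
  induction h with
  | refl a => exact .refl _
  | @head n a b c hab _ ih =>
    obtain ⟨l, v, s⟩ := a
    cases l with
    | none => simp at hab
    | some l =>
      simp only [TM2.step, Option.some.injEq] at hab
      subst hab
      refine .head ?_ ih
      simp [TM2.step, hM, stepAux_embedStmt hpr hup]

end Embed

/-- The halts of the first fragment become jumps to the second. Since every fragment ends with its
initial memory, the product memory is back in its initial state at the jump and at the end. -/
theorem Realizable.seq {R R' : Store Γ → Store Γ → ℕ → Prop} (h : Realizable R)
    (h' : Realizable R') : Realizable (Seq R R') := by
  obtain ⟨F, hF⟩ := h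
  obtain ⟨G, hG⟩ := h'
  refine ⟨{ Λ := F.Λ ⊕ G.Λ, σ := F.σ × G.σ, main := .inl F.main, init := (F.init, G.init)
            code := Sum.elim
              (fun l => embedStmt Sum.inl (some (.inr G.main)) Prod.fst (fun w v => (v, w.2))
                (F.code l))
              (fun l => embedStmt Sum.inr none Prod.snd (fun w v => (w.1, v)) (G.code l)) }, ?_⟩
  rintro s t _ ⟨u, a, b, h₁, h₂, rfl⟩
  obtain ⟨i, hi, h₁⟩ := hF s u a h₁
  obtain ⟨j, hj, h₂⟩ := hG u t b h₂
  refine ⟨i + j, Nat.add_le_add hi hj, ?_⟩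
  exact (h₁.embed (fl := Sum.inl) (ex := some (.inr G.main)) (pr := Prod.fst)
      (up := fun w v => (v, w.2)) (fun _ _ => rfl) (fun _ _ _ => rfl) (fun _ => rfl)
      (F.init, G.init)).trans
    (h₂.embed (fl := Sum.inr) (ex := none) (pr := Prod.snd) (up := fun w v => (w.1, v))
      (fun _ _ => rfl) (fun _ _ _ => rfl) (fun _ => rfl) (F.init, G.init))

/-- The effect of popping a symbol off the stack `k` and then making a transition of `R`, as long
as `k` is not empty. -/
inductive WhilePop (k : K) (R : Store Γ → Store Γ → ℕ → Prop) : Store Γ → Store Γ → ℕ → Prop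
  | done (s : Store Γ) : s k = [] → WhilePop k R s s 1
  | step {s u t : Store Γ} {a : Γ k} {l : List (Γ k)} {m n : ℕ} : s k = a :: l →
      R (update s k l) u m → WhilePop k R u t n → WhilePop k R s t (1 + (m + n))

/-- One extra bit of memory records whether the pop found a symbol. The body restores its own
memory, so it can be entered again. -/
theorem Realizable.whilePop {R : Store Γ → Store Γ → ℕ → Prop} (h : Realizable R) (k : K) :
    Realizable (WhilePop k R) := by
  obtain ⟨F, hF⟩ := h
  let G : Fragment Γ :=
    { Λ := Option F.Λ, σ := F.σ × Bool, main := none, init := (F.init, false)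
      code := fun l => l.elim
        (.pop k (fun v o => (v.1, o.isSome)) (.branch Prod.snd (.goto fun _ => some F.main) .halt))
        (fun l => embedStmt some (some none) Prod.fst (fun w v => (v, w.2)) (F.code l)) }
  refine ⟨G, ?_⟩
  -- The bit is `false` at the start but `true` after a round, so the induction has to allow both.
  suffices H : ∀ s t n, WhilePop k R s t n → ∀ b, ∃ j ≤ n,
      StepsIn (TM2.step G.code) j ⟨some G.main, (F.init, b), s⟩ ⟨none, G.init, t⟩ from
    fun s t n h => H s t n h false
  intro s t n h
  induction h with
  | done s hs =>
    intro b
    refine ⟨1, le_rfl, .single ?_⟩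
    have : update s k (s k).tail = s := by rw [hs, List.tail_nil, ← hs, update_eq_self]
    simp only [G, TM2.step, TM2.stepAux, Option.elim, this]
    simp [hs]
  | @step s u t a l m n hs hR _ ih =>
    intro b
    obtain ⟨i, hi, h₁⟩ := hF _ _ _ hR
    obtain ⟨j, hj, h₂⟩ := ih true
    refine ⟨1 + (i + j), by lia, ?_⟩
    refine StepsIn.trans (.single ?_) ((h₁.embed (fl := some) (ex := some none) (pr := Prod.fst)
      (up := fun w v => (v, w.2)) (M' := G.code) (fun _ _ => rfl) (fun _ _ _ => rfl)
      (fun _ => rfl) (F.init, true)).trans h₂)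
    simp [G, TM2.step, TM2.stepAux, hs]

end Control

/-! ### Running a fragment on some of the stacks -/

section Relabel

variable {K K' : Type} [DecidableEq K] [DecidableEq K'] {Γ : K' → Type} {ι : K → K'}
  {Λ σ : Type}

/-- The statement `q` working on the stacks `ι k`. -/
def relabelStmt (ι : K → K') : TM2.Stmt (fun k => Γ (ι k)) Λ σ → TM2.Stmt Γ Λ σ
  | .push k f q => .push (ι k) f (relabelStmt ι q)
  | .peek k f q => .peek (ι k) f (relabelStmt ι q)
  | .pop k f q => .pop (ι k) f (relabelStmt ι q)
  | .load f q => .load f (relabelStmt ι q)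
  | .branch f q q' => .branch f (relabelStmt ι q) (relabelStmt ι q')
  | .goto f => .goto f
  | .halt => .halt

/-- Injectivity keeps two stacks of the fragment from being identified. -/
theorem update_comp_injective (hι : Injective ι) (s : Store Γ) (k : K) (l : List (Γ (ι k))) :
    (fun j => update s (ι k) l (ι j)) = update (fun j => s (ι j)) k l := by
  funext j
  by_cases h : j = k
  · subst h; simp
  · rw [update_of_ne h, update_of_ne (hι.ne h)]

theorem stepAux_relabelStmt (hι : Injective ι) (q : TM2.Stmt (fun k => Γ (ι k)) Λ σ) (v : σ)
    (s : Store Γ) :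
    let c := TM2.stepAux (relabelStmt ι q) v s
    let d := TM2.stepAux q v fun k => s (ι k)
    c.l = d.l ∧ c.var = d.var ∧ (fun k => c.stk (ι k)) = d.stk ∧
      ∀ k, k ∉ Set.range ι → c.stk k = s k := by
  induction q generalizing v s with
  | push k f q ih =>
    obtain ⟨h₁, h₂, h₃, h₄⟩ := ih v (update s (ι k) (f v :: s (ι k)))
    rw [update_comp_injective hι] at h₁ h₂ h₃
    refine ⟨h₁, h₂, h₃, fun j hj => (h₄ j hj).trans (update_of_ne ?_ _ _)⟩
    rintro rfl; exact hj ⟨k, rfl⟩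
  | peek k f q ih => exact ih _ _
  | pop k f q ih =>
    obtain ⟨h₁, h₂, h₃, h₄⟩ := ih (f v (s (ι k)).head?) (update s (ι k) (s (ι k)).tail)
    rw [update_comp_injective hι] at h₁ h₂ h₃
    refine ⟨h₁, h₂, h₃, fun j hj => (h₄ j hj).trans (update_of_ne ?_ _ _)⟩
    rintro rfl; exact hj ⟨k, rfl⟩
  | load f q ih => exact ih _ _
  | branch f q q' ih ih' =>
    simp only [relabelStmt, TM2.stepAux]
    cases f v
    · exact ih' v s
    · exact ih v s
  | goto f => exact ⟨rfl, rfl, rfl, fun _ _ => rfl⟩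
  | halt => exact ⟨rfl, rfl, rfl, fun _ _ => rfl⟩

theorem StepsIn.relabel (hι : Injective ι) {M : Λ → TM2.Stmt (fun k => Γ (ι k)) Λ σ} {n : ℕ}
    {c d : TM2.Cfg (fun k => Γ (ι k)) Λ σ} (h : StepsIn (TM2.step M) n c d) :
    ∀ s : Store Γ, (fun k => s (ι k)) = c.stk → ∃ t : Store Γ, (fun k => t (ι k)) = d.stk ∧
      (∀ k, k ∉ Set.range ι → t k = s k) ∧
      StepsIn (TM2.step fun l => relabelStmt ι (M l)) n ⟨c.l, c.var, s⟩ ⟨d.l, d.var, t⟩ := by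
  induction h with
  | refl a => exact fun s hs => ⟨s, hs, fun _ _ => rfl, .refl _⟩
  | @head n a b c hab _ ih =>
    intro s hs
    obtain ⟨l, v, s'⟩ := a
    cases l with
    | none => simp at hab
    | some l =>
      simp only [TM2.step, Option.some.injEq] at hab
      subst hab
      obtain rfl : (fun k => s (ι k)) = s' := hs
      obtain ⟨h₁, h₂, h₃, h₄⟩ := stepAux_relabelStmt hι (M l) v s
      obtain ⟨t, ht, ht', h⟩ := ih _ h₃
      refine ⟨t, ht, fun k hk => (ht' k hk).trans (h₄ k hk), .head ?_ h⟩
      rw [← h₁, ← h₂]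
      rfl

theorem Realizable.relabel (hι : Injective ι)
    {R : Store (fun k => Γ (ι k)) → Store (fun k => Γ (ι k)) → ℕ → Prop} (h : Realizable R) :
    Realizable fun (s t : Store Γ) n => R (fun k => s (ι k)) (fun k => t (ι k)) n ∧
      ∀ k, k ∉ Set.range ι → t k = s k := by
  obtain ⟨F, hF⟩ := h
  refine ⟨{ Λ := F.Λ, σ := F.σ, main := F.main, init := F.init
            code := fun l => relabelStmt ι (F.code l) }, ?_⟩
  rintro s t n ⟨h, hst⟩
  obtain ⟨j, hj, h⟩ := hF _ _ _ h
  obtain ⟨t', ht', hst', h⟩ := h.relabel hι s rfl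
  obtain rfl : t' = t := by
    funext k
    by_cases hk : k ∈ Set.range ι
    · obtain ⟨k, rfl⟩ := hk
      exact congrFun ht' k
    · rw [hst' k hk, hst k hk]
  exact ⟨j, hj, h⟩

end Relabel

/-! ### Programs that read one stack to its end -/

section Scan

variable {K : Type} [DecidableEq K] {Γ : K → Type}

/-- Push the listed symbols, the first one of the list first. -/
def pushAll : List (Σ k, Γ k) → Store Γ → Store Γ
  | [], s => s
  | p :: l, s => pushAll l (update s p.1 (p.2 :: s p.1))

theorem pushAll_append (l l' : List (Σ k, Γ k)) (s : Store Γ) :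
    pushAll (l ++ l') s = pushAll l' (pushAll l s) := by
  induction l generalizing s with
  | nil => rfl
  | cons p l ih => exact ih _

theorem pushAll_map {A : Type} (k : K) (e : A → Γ k) (l : List A) (s : Store Γ) :
    pushAll (l.map fun a => ⟨k, e a⟩) s = update s k ((l.map e).reverse ++ s k) := by
  induction l generalizing s with
  | nil => simp [pushAll]
  | cons a l ih => simp [pushAll, ih]

theorem pushAll_update_of_forall_ne (l : List (Σ k, Γ k)) (k : K) (h : ∀ p ∈ l, p.1 ≠ k)
    (w : List (Γ k)) (s : Store Γ) :
    pushAll l (update s k w) = update (pushAll l s) k w := by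
  induction l generalizing s with
  | nil => rfl
  | cons p l ih =>
    have hp : p.1 ≠ k := h p (by simp)
    simp only [pushAll]
    rw [update_of_ne hp, update_comm hp.symm, ih fun p' hp' => h p' (by simp [hp'])]

theorem pushAll_apply_of_forall_ne (l : List (Σ k, Γ k)) (k : K) (h : ∀ p ∈ l, p.1 ≠ k)
    (s : Store Γ) : pushAll l s k = s k := by
  have := pushAll_update_of_forall_ne l k h (s k) s
  rw [update_eq_self] at this
  rw [this, update_self]

variable {Q A B : Type}

/-- The output of the sequential transducer with transitions `δ`, outputs `out` and final
outputs `fin`. -/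
def transduce (δ : Q → A → Q) (out : Q → A → List B) (fin : Q → List B) : Q → List A → List B
  | q, [] => fin q
  | q, a :: l => out q a ++ transduce δ out fin (δ q a) l

/-- Push the listed symbols, then continue with `q`. -/
def pushAllStmt {Λ σ : Type} : List (Σ k, Γ k) → TM2.Stmt Γ Λ σ → TM2.Stmt Γ Λ σ
  | [], q => q
  | p :: l, q => .push p.1 (fun _ => p.2) (pushAllStmt l q)

theorem stepAux_pushAllStmt {Λ σ : Type} (l : List (Σ k, Γ k)) (q : TM2.Stmt Γ Λ σ) (v : σ)
    (s : Store Γ) : TM2.stepAux (pushAllStmt l q) v s = TM2.stepAux q v (pushAll l s) := by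
  induction l generalizing s with
  | nil => rfl
  | cons p l ih => exact ih _

/-- Each symbol costs two steps, one to pop it into the control state `inr (q, a)` and one to emit
output; the last step finds the stack empty. By `hout` the output never feeds the stack being read.
-/
theorem Realizable.scan [Fintype Q] [Fintype A] (k : K) (dec : Γ k → A) (δ : Q → A → Q)
    (out : Q → A → List (Σ k, Γ k)) (fin : Q → List (Σ k, Γ k)) (q₀ : Q)
    (hout : ∀ q a, ∀ p ∈ out q a, p.1 ≠ k) :
    Realizable fun s t n =>
      t = pushAll (transduce δ out fin q₀ ((s k).map dec)) (update s k []) ∧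
        n = 2 * (s k).length + 1 := by
  let G : Fragment Γ :=
    { Λ := Q ⊕ Q × A, σ := Option A, main := .inl q₀, init := none
      code := Sum.elim
        (fun q => .pop k (fun _ o => o.map dec) (.branch Option.isSome
          (.goto fun v => v.elim (.inl q) fun a => .inr (q, a)) (pushAllStmt (fin q) .halt)))
        -- Clearing the memory makes every round start, and the program end, in the initial memory.
        (fun p => .load (fun _ => none) (pushAllStmt (out p.1 p.2)
          (.goto fun _ => .inl (δ p.1 p.2)))) }
  refine ⟨G, ?_⟩
  suffices H : ∀ (l : List (Γ k)) q s, s k = l →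
      StepsIn (TM2.step G.code) (2 * l.length + 1) ⟨some (.inl q), none, s⟩
        ⟨none, none, pushAll (transduce δ out fin q (l.map dec)) (update s k [])⟩ by
    rintro s t n ⟨rfl, rfl⟩
    exact ⟨_, le_rfl, H _ q₀ s rfl⟩
  intro l
  induction l with
  | nil =>
    intro q s hs
    refine .single ?_
    simp [G, TM2.step, hs, stepAux_pushAllStmt, transduce]
  | cons a l ih =>
    intro q s hs
    have h₁ : TM2.step G.code ⟨some (.inl q), none, s⟩ =
        some ⟨some (.inr (q, dec a)), some (dec a), update s k l⟩ := by
      simp [G, TM2.step, hs]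
    have h₂ : TM2.step G.code ⟨some (.inr (q, dec a)), some (dec a), update s k l⟩ =
        some ⟨some (.inl (δ q (dec a))), none, pushAll (out q (dec a)) (update s k l)⟩ := by
      simp [G, TM2.step, stepAux_pushAllStmt]
    refine .head h₁ (.head h₂ ?_)
    have hne := hout q (dec a)
    have h := ih (δ q (dec a)) (pushAll (out q (dec a)) (update s k l))
      ((pushAll_apply_of_forall_ne _ k hne _).trans (update_self ..))
    rwa [← pushAll_update_of_forall_ne _ k hne, update_idem, ← pushAll_append] at h

/-- Move the contents of the stack `k` onto the stack `k'`, in reverse order. -/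
def Move (k k' : K) (e : Γ k → Γ k') (s t : Store Γ) (n : ℕ) : Prop :=
  t = update (update s k []) k' (((s k).map e).reverse ++ s k') ∧ n = 2 * (s k).length + 1

theorem Realizable.move {k k' : K} [Finite (Γ k)] (hk : k' ≠ k) (e : Γ k → Γ k') :
    Realizable (Move k k' e) := by
  have := Fintype.ofFinite (Γ k)
  refine (Realizable.scan (Q := Unit) k id (fun _ _ => ()) (fun _ a => [⟨k', e a⟩])
    (fun _ => []) () (by rintro _ _ _ h; simp at h; subst h; exact hk)).mono ?_
  rintro s t n ⟨rfl, rfl⟩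
  refine ⟨_, le_rfl, ?_, rfl⟩
  have h : ∀ l : List (Γ k), transduce (fun _ _ => ()) (fun _ a => [⟨k', e a⟩]) (fun _ => []) () l =
      l.map fun a => (⟨k', e a⟩ : Σ k, Γ k) := by
    intro l
    induction l with
    | nil => rfl
    | cons a l ih => simp [transduce, ih]
  rw [h, pushAll_map, update_of_ne hk]
  simp

/-- Move the contents of the stack `k` onto both stacks `k₁` and `k₂`, in reverse order. -/
def Copy (k k₁ k₂ : K) (e₁ : Γ k → Γ k₁) (e₂ : Γ k → Γ k₂) (s t : Store Γ) (n : ℕ) : Prop :=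
  t = update (update (update s k []) k₁ (((s k).map e₁).reverse ++ s k₁)) k₂
    (((s k).map e₂).reverse ++ s k₂) ∧ n = 2 * (s k).length + 1

theorem Realizable.copy {k k₁ k₂ : K} [Finite (Γ k)] (h₁ : k₁ ≠ k) (h₂ : k₂ ≠ k) (h₁₂ : k₁ ≠ k₂)
    (e₁ : Γ k → Γ k₁) (e₂ : Γ k → Γ k₂) : Realizable (Copy k k₁ k₂ e₁ e₂) := by
  have := Fintype.ofFinite (Γ k)
  refine (Realizable.scan (Q := Unit) k id (fun _ _ => ()) (fun _ a => [⟨k₁, e₁ a⟩, ⟨k₂, e₂ a⟩])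
    (fun _ => []) () ?_).mono ?_
  · rintro _ _ _ h
    simp only [List.mem_cons, List.not_mem_nil, or_false] at h
    rcases h with rfl | rfl
    exacts [h₁, h₂]
  rintro s t n ⟨rfl, rfl⟩
  refine ⟨_, le_rfl, ?_, rfl⟩
  have h : ∀ (l : List (Γ k)) (s : Store Γ), pushAll (transduce (fun _ _ => ())
      (fun _ a => [⟨k₁, e₁ a⟩, ⟨k₂, e₂ a⟩]) (fun _ => []) () l) s =
      update (update s k₁ ((l.map e₁).reverse ++ s k₁)) k₂ ((l.map e₂).reverse ++ s k₂) := by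
    intro l
    induction l with
    | nil => intro s; simp [transduce, pushAll]
    | cons a l ih =>
      intro s
      rw [transduce, pushAll_append, ih]
      simp only [pushAll, update_self, update_of_ne h₁₂, update_of_ne h₁₂.symm, update_idem,
        update_comm h₁₂, List.map_cons, List.reverse_cons, List.append_assoc, List.singleton_append]
  rw [List.map_id, h, update_of_ne h₁, update_of_ne h₂]

/-- Move the contents of the stack `k` onto `k₁` and `k₂`, in reverse order, where the symbols for
`k₁` precede those for `k₂`. -/
def Split (k k₁ k₂ : K) (e : Γ k → Γ k₁ ⊕ Γ k₂) (s t : Store Γ) (n : ℕ) : Prop :=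
  ∃ (u : List (Γ k₁)) (v : List (Γ k₂)), (s k).map e = u.map Sum.inl ++ v.map Sum.inr ∧
    t = update (update (update s k []) k₁ (u.reverse ++ s k₁)) k₂ (v.reverse ++ s k₂) ∧
    n = 2 * (s k).length + 1

theorem Realizable.split {k k₁ k₂ : K} [Finite (Γ k)] (h₁ : k₁ ≠ k) (h₂ : k₂ ≠ k) (h₁₂ : k₁ ≠ k₂)
    (e : Γ k → Γ k₁ ⊕ Γ k₂) : Realizable (Split k k₁ k₂ e) := by
  have := Fintype.ofFinite (Γ k)
  let o : Γ k₁ ⊕ Γ k₂ → Σ k, Γ k := Sum.elim (fun a => ⟨k₁, a⟩) (fun a => ⟨k₂, a⟩)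
  refine (Realizable.scan (Q := Unit) k id (fun _ _ => ()) (fun _ a => [o (e a)])
    (fun _ => []) () ?_).mono ?_
  · rintro _ a _ h
    simp only [List.mem_cons, List.not_mem_nil, or_false] at h
    subst h
    cases e a
    exacts [h₁, h₂]
  rintro s t n ⟨u, v, huv, rfl, rfl⟩
  refine ⟨_, le_rfl, ?_, rfl⟩
  have h : ∀ (l : List (Γ k)), transduce (fun _ _ => ())
      (fun _ a => [o (e a)]) (fun _ => []) () l = (l.map e).map o := by
    intro l
    induction l with
    | nil => rfl
    | cons a l ih => simp [transduce, ih]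
  rw [List.map_id, h, huv, List.map_append, pushAll_append, List.map_map, List.map_map]
  have h₃ := pushAll_map (Γ := Γ) k₁ id u (update s k [])
  have h₄ := pushAll_map (Γ := Γ) k₂ id v
  simp only [id, List.map_id] at h₃ h₄
  refine Eq.trans ?_ (congrArg (pushAll _) h₃.symm)
  refine Eq.trans ?_ (h₄ _).symm
  rw [update_of_ne h₁, update_of_ne h₁₂.symm, update_of_ne h₂]

end Scan

end Ranking

namespace Ranking

open Turing Function

/-! ### Polynomial bounds -/

theorem eval_mono (p : Polynomial ℕ) : Monotone fun n => p.eval n := by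
  intro m n h
  simp only [Polynomial.eval_eq_sum, Polynomial.sum]
  gcongr

/-! ### Start and end configurations, growth of stacks -/

section Machines

variable {K : Type} [DecidableEq K] {Γ : K → Type}

/-- The stacks with the contents `w` of the stack `k`, the other ones being empty. -/
def single (k : K) (w : List (Γ k)) : Store Γ := update (fun _ => []) k w

@[simp]
theorem single_self (k : K) (w : List (Γ k)) : single k w k = w := update_self ..

theorem single_nil (k : K) : single k [] = (fun _ => [] : Store Γ) := update_eq_self ..

@[simp]
theorem update_single (k : K) (w w' : List (Γ k)) : update (single k w) k w' = single k w' :=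
  update_idem ..

theorem initList_eq (M : FinTM2) (w : List (M.Γ M.k₀)) :
    initList M w = ⟨some M.main, M.initialState, single M.k₀ w⟩ := by
  have : (initList M w).stk = single M.k₀ w := by
    funext k
    by_cases h : k = M.k₀
    · subst h; simp [initList]
    · simp [initList, single, h]
  rw [← this]; rfl

theorem haltList_eq (M : FinTM2) (w : List (M.Γ M.k₁)) :
    haltList M w = ⟨none, M.initialState, single M.k₁ w⟩ := by
  have : (haltList M w).stk = single M.k₁ w := by
    funext k
    by_cases h : k = M.k₁
    · subst h; simp [haltList]
    · simp [haltList, single, h]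
  rw [← this]; rfl

/-- The number of pushes in a statement. -/
def numPushes {Λ σ : Type} : TM2.Stmt Γ Λ σ → ℕ
  | .push _ _ q => numPushes q + 1
  | .peek _ _ q => numPushes q
  | .pop _ _ q => numPushes q
  | .load _ q => numPushes q
  | .branch _ q q' => numPushes q + numPushes q'
  | .goto _ => 0
  | .halt => 0

theorem length_stepAux_le {Λ σ : Type} (q : TM2.Stmt Γ Λ σ) (v : σ) (s : Store Γ) (k : K) :
    ((TM2.stepAux q v s).stk k).length ≤ (s k).length + numPushes q := by
  induction q generalizing v s with
  | push k' f q ih =>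
    refine (ih _ _).trans ?_
    by_cases h : k = k'
    · subst h; simp [numPushes]; lia
    · simp [numPushes, h]
  | peek k f q ih => exact ih _ _
  | pop k' f q ih =>
    refine (ih _ _).trans ?_
    by_cases h : k = k'
    · subst h; simp [numPushes]
    · simp [numPushes, h]
  | load f q ih => exact ih _ _
  | branch f q q' ih ih' =>
    simp only [TM2.stepAux, numPushes]
    cases f v
    · have := ih' v s; simp only [cond_false]; lia
    · have := ih v s; simp only [cond_true]; lia
  | goto f => simp [numPushes]
  | halt => simp [numPushes]

/-- A step executes one statement, hence makes a bounded number of pushes. This turns time bounds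
into bounds on output length. -/
theorem StepsIn.length_le {Λ σ : Type} [Fintype Λ] {M : Λ → TM2.Stmt Γ Λ σ} {n : ℕ}
    {c d : TM2.Cfg Γ Λ σ} (h : StepsIn (TM2.step M) n c d) (k : K) :
    (d.stk k).length ≤ (c.stk k).length + n * ∑ l, numPushes (M l) := by
  induction h with
  | refl a => simp
  | @head n a b c hab _ ih =>
    obtain ⟨l, v, s⟩ := a
    cases l with
    | none => simp at hab
    | some l =>
      simp only [TM2.step, Option.some.injEq] at hab
      subst hab
      have h₁ := length_stepAux_le (M l) v s k
      have h₂ : numPushes (M l) ≤ ∑ l, numPushes (M l) :=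
        Finset.single_le_sum (f := fun l => numPushes (M l)) (fun _ _ => Nat.zero_le _)
          (Finset.mem_univ l)
      simp only at h₁ ih ⊢
      rw [add_mul, one_mul]
      lia

end Machines

/-! ### Translation between machines and realizable relations -/

section PolyTime

variable {α β γ αΓ βΓ γΓ : Type} {ea : α → List αΓ} {eb : β → List βΓ} {ec : γ → List γΓ}
  {f : α → β}

/-- A fragment is a machine once input and output stacks are chosen; all other stacks must be empty
at both ends, as `initList` and `haltList` require. -/
theorem polyTime_of_realizable {K : Type} [DecidableEq K] [Fintype K] {Γ : K → Type}
    {R : Store Γ → Store Γ → ℕ → Prop} (hR : Realizable R) (k₀ k₁ : K) [Finite (Γ k₀)]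
    (i : Γ k₀ ≃ αΓ) (o : Γ k₁ ≃ βΓ) (p : Polynomial ℕ)
    (h : ∀ a, ∃ s t n, R s t n ∧ s = single k₀ ((ea a).map i.symm) ∧
      t = single k₁ ((eb (f a)).map o.symm) ∧ n ≤ p.eval (ea a).length) :
    PolyTime ea eb f := by
  obtain ⟨F, hF⟩ := hR
  have := Fintype.ofFinite (Γ k₀)
  let M : FinTM2 := { K := K, k₀ := k₀, k₁ := k₁, Γ := Γ, Λ := F.Λ, main := F.main, σ := F.σ,
                      initialState := F.init, m := F.code }
  refine ⟨{ tm := M, inputAlphabet := i, outputAlphabet := o, time := p, outputsFun := ?_ }⟩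
  intro a
  have : ∃ j ≤ p.eval (ea a).length, StepsIn (TM2.step F.code) j
      (initList M ((ea a).map i.invFun)) (haltList M ((eb (f a)).map o.invFun)) := by
    obtain ⟨_, _, n, h, rfl, rfl, hn⟩ := h a
    obtain ⟨j, hj, h⟩ := hF _ _ _ h
    rw [initList_eq, haltList_eq]
    exact ⟨j, hj.trans hn, h⟩
  exact { steps := this.choose
          evals_in_steps := StepsIn.iff_iterate.1 this.choose_spec.2
          steps_le_m := this.choose_spec.1 }

theorem PolyTime.exists_realizable (h : PolyTime ea eb f) :
    ∃ (K : Type) (_ : DecidableEq K) (_ : Fintype K) (Γ : K → Type) (k₀ k₁ : K)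
      (_ : Finite (Γ k₀)) (i : Γ k₀ ≃ αΓ) (o : Γ k₁ ≃ βΓ) (p : Polynomial ℕ),
      (∀ a, (eb (f a)).length ≤ p.eval (ea a).length) ∧
      Realizable fun s t n => ∃ a, s = single k₀ ((ea a).map i.symm) ∧
        t = single k₁ ((eb (f a)).map o.symm) ∧ n = p.eval (ea a).length := by
  obtain ⟨⟨M, i, o⟩, p, h⟩ := h
  have hs : ∀ a, ∃ j ≤ p.eval (ea a).length, StepsIn (TM2.step M.m) j
      ⟨some M.main, M.initialState, single M.k₀ ((ea a).map i.symm)⟩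
      ⟨none, M.initialState, single M.k₁ ((eb (f a)).map o.symm)⟩ := fun a => by
    rw [← initList_eq, ← haltList_eq]
    exact ⟨(h a).steps, (h a).steps_le_m, StepsIn.iff_iterate.2 (h a).evals_in_steps⟩
  have := M.Γk₀Fin
  have := M.ΛFin
  have := M.σFin
  refine ⟨M.K, M.kDecidableEq, M.kFin, M.Γ, M.k₀, M.k₁, inferInstance, i, o,
    -- One polynomial dominates both the running time and the output length.
    p * Polynomial.C (∑ l, numPushes (M.m l) + 1) + Polynomial.X, fun a => ?_, ?_⟩
  · obtain ⟨j, hj, h⟩ := hs a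
    have hl := h.length_le M.k₁
    -- The output stack may be the input stack, which accounts for the summand `X`.
    have h₀ : (single (Γ := M.Γ) M.k₀ ((ea a).map i.symm) M.k₁).length ≤ (ea a).length := by
      by_cases hk : M.k₁ = M.k₀
      · rw [hk]; simp
      · simp [single, hk]
    simp only [single_self, List.length_map] at hl
    simp only [Polynomial.eval_add, Polynomial.eval_mul, Polynomial.eval_C, Polynomial.eval_X]
    have := Nat.mul_le_mul_right (∑ l, numPushes (M.m l)) hj
    rw [mul_add, mul_one]
    lia
  · refine ⟨{ Λ := M.Λ, σ := M.σ, main := M.main, init := M.initialState, code := M.m }, ?_⟩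
    rintro _ _ _ ⟨a, rfl, rfl, rfl⟩
    obtain ⟨j, hj, h⟩ := hs a
    refine ⟨j, hj.trans ?_, h⟩
    simp only [Polynomial.eval_add, Polynomial.eval_mul, Polynomial.eval_C, Polynomial.eval_X]
    nlinarith [Nat.zero_le (Polynomial.eval (ea a).length p * ∑ l, numPushes (M.m l))]

end PolyTime

/-! ### Disjoint unions of stack families -/

section Join

variable {K L : Type} {Γ : K → Type} {Δ : L → Type}

/-- The family of the types in `Γ` and those in `Δ`. -/
abbrev SumFam (Γ : K → Type) (Δ : L → Type) : K ⊕ L → Type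
  | .inl k => Γ k
  | .inr l => Δ l

/-- The stacks `a` next to the stacks `b`. -/
def join (a : Store Γ) (b : Store Δ) : Store (SumFam Γ Δ)
  | .inl k => a k
  | .inr l => b l

@[simp]
theorem join_inl (a : Store Γ) (b : Store Δ) (k : K) : join a b (.inl k) = a k := rfl

@[simp]
theorem join_inr (a : Store Γ) (b : Store Δ) (l : L) : join a b (.inr l) = b l := rfl

theorem join_nil_nil : join (fun _ => [] : Store Γ) (fun _ => [] : Store Δ) = fun _ => [] := by
  funext k; cases k <;> rfl

variable [DecidableEq K] [DecidableEq L]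

@[simp]
theorem update_join_inl (a : Store Γ) (b : Store Δ) (k : K) (w : List (Γ k)) :
    update (join a b) (.inl k) w = join (update a k w) b := by
  funext j
  rcases j with j | j
  · by_cases h : j = k
    · subst h; simp
    · rw [update_of_ne (by simpa using h)]; simp [h]
  · rw [update_of_ne (by simp)]; simp

@[simp]
theorem update_join_inr (a : Store Γ) (b : Store Δ) (l : L) (w : List (Δ l)) :
    update (join a b) (.inr l) w = join a (update b l w) := by
  funext j
  rcases j with j | j
  · rw [update_of_ne (by simp)]; simp
  · by_cases h : j = l
    · subst h; simp
    · rw [update_of_ne (by simpa using h)]; simp [h]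

theorem single_inl (k : K) (w : List (Γ k)) :
    (single (.inl k) w : Store (SumFam Γ Δ)) = join (single k w) fun _ => [] := by
  rw [single, ← join_nil_nil, update_join_inl]; rfl

theorem single_inr (l : L) (w : List (Δ l)) :
    (single (.inr l) w : Store (SumFam Γ Δ)) = join (fun _ => []) (single l w) := by
  rw [single, ← join_nil_nil, update_join_inr]; rfl

theorem Realizable.inl {R : Store Γ → Store Γ → ℕ → Prop} (h : Realizable R) (Δ : L → Type) :
    Realizable fun (s t : Store (SumFam Γ Δ)) n =>
      ∃ a a' b, s = join a b ∧ t = join a' b ∧ R a a' n := by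
  refine (Realizable.relabel (Γ := SumFam Γ Δ) Sum.inl_injective h).mono ?_
  rintro _ _ n ⟨a, a', b, rfl, rfl, h⟩
  refine ⟨n, le_rfl, h, ?_⟩
  rintro (k | k) hk
  · simp at hk
  · rfl

theorem Realizable.inr {R : Store Δ → Store Δ → ℕ → Prop} (h : Realizable R) (Γ : K → Type) :
    Realizable fun (s t : Store (SumFam Γ Δ)) n =>
      ∃ a b b', s = join a b ∧ t = join a b' ∧ R b b' n := by
  refine (Realizable.relabel (Γ := SumFam Γ Δ) Sum.inr_injective h).mono ?_
  rintro _ _ n ⟨a, b, b', rfl, rfl, h⟩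
  refine ⟨n, le_rfl, h, ?_⟩
  rintro (k | k) hk
  · rfl
  · simp at hk

/-- One stack with the contents `w`. -/
def stack {A : Type} (w : List A) : Store fun _ : Unit => A := fun _ => w

@[simp]
theorem stack_apply {A : Type} (w : List A) (u : Unit) : stack w u = w := rfl

@[simp]
theorem update_stack {A : Type} (w w' : List A) (u : Unit) : update (stack w) u w' = stack w' := by
  funext; simp

end Join

end Ranking

namespace Ranking

open Turing Function

/-! ### Closure properties of polynomial time -/

section Closure

variable {α β γ αΓ βΓ γΓ : Type} {ea : α → List αΓ} {eb : β → List βΓ} {ec : γ → List γΓ}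

/-- The machines run on disjoint stacks. The intermediate word passes through an auxiliary stack, so
that its two reversals cancel; its length is at most `p`, whence the time `p'.comp p`. -/
theorem PolyTime.comp [Finite βΓ] {f : α → β} {g : β → γ} (hg : PolyTime eb ec g)
    (hf : PolyTime ea eb f) : PolyTime ea ec fun a => g (f a) := by
  obtain ⟨K, _, _, Γ, k₀, k₁, _, i, o, p, hp, hM⟩ := hf.exists_realizable
  obtain ⟨L, _, _, Δ, l₀, l₁, _, i', o', p', -, hN⟩ := hg.exists_realizable
  have : Finite (Γ k₁) := Finite.of_equiv _ o.symm
  let Θ : Unit → Type := fun _ => βΓ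
  have h₁ := hM.inl (SumFam Δ Θ)
  have h₂ := Realizable.move (Γ := SumFam Γ (SumFam Δ Θ)) (k := .inl k₁) (k' := .inr (.inr ()))
    (by simp) o
  have h₃ := Realizable.move (Γ := SumFam Γ (SumFam Δ Θ)) (k := .inr (.inr ()))
    (k' := .inr (.inl l₀)) (by simp) i'.symm
  have h₄ := (hN.inl Θ).inr Γ
  refine polyTime_of_realizable (((h₁.seq h₂).seq h₃).seq h₄) (.inl k₀) (.inr (.inl l₁)) i o'
    (p + (2 * p + 1) + (2 * p + 1) + p'.comp p) fun a => ?_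
  let st (u : Store Γ) (v : Store Δ) (w : List βΓ) : Store (SumFam Γ (SumFam Δ Θ)) :=
    join u (join v (stack w))
  let b := eb (f a)
  have s₂ : Move (Γ := SumFam Γ (SumFam Δ Θ)) (.inl k₁) (.inr (.inr ())) o
      (st (single k₁ (b.map o.symm)) (fun _ => []) [])
      (st (fun _ => []) (fun _ => []) b.reverse) (2 * b.length + 1) := by
    simp [Move, st, single_nil, Function.comp_def]
  have s₃ : Move (Γ := SumFam Γ (SumFam Δ Θ)) (.inr (.inr ())) (.inr (.inl l₀)) i'.symm
      (st (fun _ => []) (fun _ => []) b.reverse)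
      (st (fun _ => []) (single l₀ (b.map i'.symm)) []) (2 * b.length + 1) := by
    simp [Move, st]
    rfl
  refine ⟨st (single k₀ ((ea a).map i.symm)) (fun _ => []) [],
    st (fun _ => []) (single l₁ ((ec (g (f a))).map o'.symm)) [], _,
    .intro (.intro (.intro ⟨_, _, _, rfl, rfl, a, rfl, rfl, rfl⟩ s₂) s₃)
      ⟨_, _, _, rfl, rfl, _, _, _, rfl, rfl, f a, rfl, rfl, rfl⟩, ?_, ?_, ?_⟩
  · exact ((single_inl k₀ _).trans (congrArg _ join_nil_nil.symm)).symm
  · exact ((single_inr (Sum.inl l₁) _).trans (congrArg _ (single_inl (Γ := Δ) l₁ _))).symm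
  · have hm' : p'.eval b.length ≤ _ := eval_mono p' (hp a)
    simp only [Polynomial.eval_add, Polynomial.eval_mul, Polynomial.eval_comp,
      Polynomial.eval_one, Polynomial.eval_ofNat]
    have := hp a
    gcongr

/-- The encoding of a pair by the encoding of its first component, followed by that of the second
one, over disjoint alphabets. -/
def encodeProd (ea : α → List αΓ) (eb : β → List βΓ) (p : α × β) : List (αΓ ⊕ βΓ) :=
  (ea p.1).map Sum.inl ++ (eb p.2).map Sum.inr

/-- The input is copied for both machines. Their outputs are piled up reversed on `kmid`, and one
last move restores the order. -/
theorem PolyTime.pair [Finite αΓ] [Finite βΓ] [Finite γΓ] {f : α → β} {g : α → γ}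
    (hf : PolyTime ea eb f) (hg : PolyTime ea ec g) :
    PolyTime ea (encodeProd eb ec) fun a => (f a, g a) := by
  obtain ⟨K, _, _, Γ, k₀, k₁, _, i, o, p, hp, hM⟩ := hf.exists_realizable
  obtain ⟨L, _, _, Δ, l₀, l₁, _, i', o', p', hp', hN⟩ := hg.exists_realizable
  have : Finite (Γ k₁) := Finite.of_equiv _ o.symm
  have : Finite (Δ l₁) := Finite.of_equiv _ o'.symm
  let A : Unit → Type := fun _ => αΓ
  let B : Unit → Type := fun _ => βΓ ⊕ γΓ
  let Θ := SumFam Γ (SumFam Δ (SumFam A (SumFam A (SumFam B B))))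
  let kin : K ⊕ L ⊕ Unit ⊕ Unit ⊕ Unit ⊕ Unit := .inr (.inr (.inl ()))
  let kaux : K ⊕ L ⊕ Unit ⊕ Unit ⊕ Unit ⊕ Unit := .inr (.inr (.inr (.inl ())))
  let kmid : K ⊕ L ⊕ Unit ⊕ Unit ⊕ Unit ⊕ Unit := .inr (.inr (.inr (.inr (.inl ()))))
  let kout : K ⊕ L ⊕ Unit ⊕ Unit ⊕ Unit ⊕ Unit := .inr (.inr (.inr (.inr (.inr ()))))
  have h₁ := Realizable.move (Γ := Θ) (k := kin) (k' := kaux) (by simp [kin, kaux]) id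
  have h₂ := Realizable.copy (Γ := Θ) (k := kaux) (k₁ := .inl k₀) (k₂ := .inr (.inl l₀))
    (by simp [kaux]) (by simp [kaux]) (by simp) i.symm i'.symm
  have h₃ := hM.inl (SumFam Δ (SumFam A (SumFam A (SumFam B B))))
  have h₄ := (hN.inl (SumFam A (SumFam A (SumFam B B)))).inr Γ
  have h₅ := Realizable.move (Γ := Θ) (k := .inl k₁) (k' := kmid) (by simp [kmid])
    fun x => .inl (o x)
  have h₆ := Realizable.move (Γ := Θ) (k := .inr (.inl l₁)) (k' := kmid) (by simp [kmid])
    fun x => .inr (o' x)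
  have h₇ := Realizable.move (Γ := Θ) (k := kmid) (k' := kout) (by simp [kmid, kout]) id
  refine polyTime_of_realizable ((((((h₁.seq h₂).seq h₃).seq h₄).seq h₅).seq h₆).seq h₇)
    kin kout (Equiv.refl _) (Equiv.refl _)
    ((2 * .X + 1) + (2 * .X + 1) + p + p' + (2 * p + 1) + (2 * p' + 1) + (2 * (p + p') + 1))
    fun a => ?_
  let st (u : Store Γ) (v : Store Δ) (w x : List αΓ) (y z : List (βΓ ⊕ γΓ)) : Store Θ :=
    join u (join v (join (stack w) (join (stack x) (join (stack y) (stack z)))))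
  let b := eb (f a)
  let c := ec (g a)
  have s₁ : Move (Γ := Θ) kin kaux id
      (st (fun _ => []) (fun _ => []) (ea a) [] [] [])
      (st (fun _ => []) (fun _ => []) [] (ea a).reverse [] []) (2 * (ea a).length + 1) := by
    simp [Move, st, kin, kaux, Θ]
  have s₂ : Copy (Γ := Θ) kaux (.inl k₀) (.inr (.inl l₀)) i.symm i'.symm
      (st (fun _ => []) (fun _ => []) [] (ea a).reverse [] [])
      (st (single k₀ ((ea a).map i.symm)) (single l₀ ((ea a).map i'.symm)) [] [] [] [])
      (2 * (ea a).length + 1) := by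
    simp [Copy, st, kaux, Θ]
    rfl
  have s₅ : Move (Γ := Θ) (.inl k₁) kmid (fun x => .inl (o x))
      (st (single k₁ (b.map o.symm)) (single l₁ (c.map o'.symm)) [] [] [] [])
      (st (fun _ => []) (single l₁ (c.map o'.symm)) [] [] (b.map Sum.inl).reverse [])
      (2 * b.length + 1) := by
    simp [Move, st, single_nil, Function.comp_def, kmid, Θ]
  have s₆ : Move (Γ := Θ) (.inr (.inl l₁)) kmid (fun x => .inr (o' x))
      (st (fun _ => []) (single l₁ (c.map o'.symm)) [] [] (b.map Sum.inl).reverse [])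
      (st (fun _ => []) (fun _ => []) [] [] (encodeProd eb ec (f a, g a)).reverse [])
      (2 * c.length + 1) := by
    simp [Move, st, single_nil, Function.comp_def, kmid, Θ, encodeProd, b, c]
  have s₇ : Move (Γ := Θ) kmid kout id
      (st (fun _ => []) (fun _ => []) [] [] (encodeProd eb ec (f a, g a)).reverse [])
      (st (fun _ => []) (fun _ => []) [] [] [] (encodeProd eb ec (f a, g a)))
      (2 * (b.length + c.length) + 1) := by
    simp [Move, st, kmid, kout, Θ, encodeProd, b, c, add_comm]
  refine ⟨_, _, _, .intro (.intro (.intro (.intro (.intro (.intro s₁ s₂)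
      ⟨_, _, _, rfl, rfl, a, rfl, rfl, rfl⟩)
      ⟨_, _, _, rfl, rfl, _, _, _, rfl, rfl, a, rfl, rfl, rfl⟩) s₅) s₆) s₇, ?_, ?_, ?_⟩
  · rw [Equiv.refl_symm, Equiv.coe_refl, List.map_id]
    funext k
    rcases k with k | k | k | k | k | k <;> rfl
  · rw [Equiv.refl_symm, Equiv.coe_refl, List.map_id]
    funext k
    rcases k with k | k | k | k | k | k <;> rfl
  · simp only [Polynomial.eval_add, Polynomial.eval_mul, Polynomial.eval_X,
      Polynomial.eval_one, Polynomial.eval_ofNat]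
    have := hp a
    have := hp' a
    gcongr

/-- Iterate `h` as many times as the first component is long. -/
theorem PolyTime.iterate [Finite αΓ] [Finite βΓ] {h : α → α} (hh : PolyTime ea ea h)
    (q : Polynomial ℕ) (hq : ∀ a n, (ea (h^[n] a)).length ≤ q.eval ((ea a).length + n)) :
    PolyTime (encodeProd eb ea) ea fun x : β × α => h^[(eb x.1).length] x.2 := by
  obtain ⟨K, _, _, Γ, k₀, k₁, _, i, o, p, -, hM⟩ := hh.exists_realizable
  have : Finite (Γ k₁) := Finite.of_equiv _ o.symm
  let A : Unit → Type := fun _ => αΓ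
  let B : Unit → Type := fun _ => βΓ
  let C : Unit → Type := fun _ => βΓ ⊕ αΓ
  let Θ := SumFam Γ (SumFam A (SumFam A (SumFam B C)))
  let kaux : K ⊕ Unit ⊕ Unit ⊕ Unit ⊕ Unit := .inr (.inl ())
  let kout : K ⊕ Unit ⊕ Unit ⊕ Unit ⊕ Unit := .inr (.inr (.inl ()))
  let kcnt : K ⊕ Unit ⊕ Unit ⊕ Unit ⊕ Unit := .inr (.inr (.inr (.inl ())))
  let kin : K ⊕ Unit ⊕ Unit ⊕ Unit ⊕ Unit := .inr (.inr (.inr (.inr ())))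
  have h₁ := Realizable.split (Γ := Θ) (k := kin) (k₁ := kcnt) (k₂ := kaux)
    (by simp [kin, kcnt]) (by simp [kin, kaux]) (by simp [kcnt, kaux]) id
  have h₂ := Realizable.move (Γ := Θ) (k := kaux) (k' := .inl k₀) (by simp [kaux]) i.symm
  have h₃ := hM.inl (SumFam A (SumFam A (SumFam B C)))
  have h₄ := Realizable.move (Γ := Θ) (k := .inl k₁) (k' := kaux) (by simp [kaux]) o
  have h₅ := Realizable.move (Γ := Θ) (k := .inl k₀) (k' := kaux) (by simp [kaux]) i
  have h₆ := Realizable.move (Γ := Θ) (k := kaux) (k' := kout) (by simp [kaux, kout]) id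
  refine polyTime_of_realizable
    ((((h₁.seq h₂).seq (((h₃.seq h₄).seq h₂).whilePop kcnt)).seq h₅).seq h₆)
    kin kout (Equiv.refl _) (Equiv.refl _)
    ((2 * .X + 1) + (2 * .X + 1) + ((p.comp q + (2 * q + 1) + (2 * q + 1) + 1) * .X + 1) +
      (2 * q + 1) + (2 * q + 1)) ?_
  rintro ⟨b, a⟩
  let st (u : Store Γ) (x y : List αΓ) (v : List βΓ) (w : List (βΓ ⊕ αΓ)) : Store Θ :=
    join u (join (stack x) (join (stack y) (join (stack v) (stack w))))
  let e : Store Γ := fun _ => []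
  let N := (ea a).length + (eb b).length
  let T := p.eval (q.eval N) + (2 * q.eval N + 1) + (2 * q.eval N + 1)
  have s₁ : Split (Γ := Θ) kin kcnt kaux id (st e [] [] [] (encodeProd eb ea (b, a)))
      (st e (ea a).reverse [] (eb b).reverse []) (2 * N + 1) :=
    ⟨eb b, ea a, by simp [st, kin, Θ, encodeProd], by simp [st, kin, kcnt, kaux, Θ],
      by simp [st, kin, Θ, encodeProd, N, add_comm]⟩
  have s₂ : ∀ (a : α) (v : List βΓ), Move (Γ := Θ) kaux (.inl k₀) i.symm
      (st e (ea a).reverse [] v []) (st (single k₀ ((ea a).map i.symm)) [] [] v [])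
      (2 * (ea a).length + 1) := by
    intro a v
    simp [Move, st, kaux, Θ, e]
    rfl
  have s₄ : ∀ (a : α) (v : List βΓ), Move (Γ := Θ) (.inl k₁) kaux o
      (st (single k₁ ((ea a).map o.symm)) [] [] v []) (st e (ea a).reverse [] v [])
      (2 * (ea a).length + 1) := by
    intro a v
    simp [Move, st, kaux, Θ, e, single_nil, Function.comp_def]
  have s₅ : ∀ a : α, Move (Γ := Θ) (.inl k₀) kaux i
      (st (single k₀ ((ea a).map i.symm)) [] [] [] []) (st e (ea a).reverse [] [] [])
      (2 * (ea a).length + 1) := by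
    intro a
    simp [Move, st, kaux, Θ, e, single_nil, Function.comp_def]
  have s₆ : ∀ a : α, Move (Γ := Θ) kaux kout id (st e (ea a).reverse [] [] [])
      (st e [] (ea a) [] []) (2 * (ea a).length + 1) := by
    intro a
    simp [Move, st, kaux, kout, Θ]
  -- All intermediate values obey one bound, so `T` serves for every round; without `hq` their
  -- lengths could grow exponentially.
  have hlen : ∀ j ≤ (eb b).length, (ea (h^[j] a)).length ≤ q.eval N := fun j hj =>
    (hq a j).trans (eval_mono q (Nat.add_le_add_left hj _))
  -- Here `v` is what remains of the counter and `j` the number of rounds done.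
  have s₃ : ∀ (v : List βΓ) (j : ℕ), v.length + j = (eb b).length → ∃ n ≤ (T + 1) * v.length + 1,
      WhilePop kcnt (Seq (Seq (fun s t n => ∃ a a' b, s = join a b ∧ t = join a' b ∧ ∃ x,
        a = single k₀ ((ea x).map i.symm) ∧ a' = single k₁ ((ea (h x)).map o.symm) ∧
          n = p.eval (ea x).length) (Move (Γ := Θ) (.inl k₁) kaux o))
            (Move (Γ := Θ) kaux (.inl k₀) i.symm))
        (st (single k₀ ((ea (h^[j] a)).map i.symm)) [] [] v [])
        (st (single k₀ ((ea (h^[v.length + j] a)).map i.symm)) [] [] [] []) n := by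
    intro v
    induction v with
    | nil => exact fun j _ => ⟨1, by simp, by simpa using .done _ rfl⟩
    | cons y v ih =>
      intro j hj
      obtain ⟨n, hn, hw⟩ := ih (j + 1) (by simp at hj; lia)
      have hj' : j + 1 ≤ (eb b).length := by simp at hj; lia
      rw [show v.length + (j + 1) = (y :: v).length + j by simp; lia] at hw
      have hT : p.eval (ea (h^[j] a)).length + (2 * (ea (h^[j + 1] a)).length + 1) +
          (2 * (ea (h^[j + 1] a)).length + 1) ≤ T := by
        have h₁ := eval_mono p (hlen j (by lia))
        have h₂ := hlen (j + 1) hj'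
        simp only at h₁
        lia
      refine ⟨_, ?_, .step (a := y) (l := v) rfl (.intro (.intro
        (u := st (single k₁ ((ea (h^[j + 1] a)).map o.symm)) [] [] v [])
        ⟨single k₀ ((ea (h^[j] a)).map i.symm), _, _, ?_, rfl, h^[j] a, rfl,
          by rw [iterate_succ_apply'], rfl⟩ (s₄ _ v)) (s₂ _ v)) hw⟩
      · rw [List.length_cons, mul_add, mul_one]
        lia
      · simp [st, kcnt]
  obtain ⟨n, hn, hw⟩ := s₃ (eb b).reverse 0 (by simp)
  simp only [List.length_reverse, add_zero, iterate_zero, id] at hw hn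
  refine ⟨_, _, _, .intro (.intro (.intro (.intro s₁ (s₂ a _)) hw) (s₅ _)) (s₆ _), ?_, ?_, ?_⟩
  · rw [Equiv.refl_symm, Equiv.coe_refl, List.map_id]
    funext k
    rcases k with k | k | k | k | k <;> rfl
  · rw [Equiv.refl_symm, Equiv.coe_refl, List.map_id]
    funext k
    rcases k with k | k | k | k | k <;> rfl
  · have hN : (encodeProd eb ea (b, a)).length = N := by simp [encodeProd, N, add_comm]
    rw [hN]
    simp only [Polynomial.eval_add, Polynomial.eval_mul, Polynomial.eval_X, Polynomial.eval_comp,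
      Polynomial.eval_one, Polynomial.eval_ofNat]
    have h₁ := hlen _ le_rfl
    have h₂ : (ea a).length ≤ N := Nat.le_add_right _ _
    have h₃ : (eb b).length ≤ N := Nat.le_add_left _ _
    have h₄ := hn.trans (Nat.add_le_add_right (Nat.mul_le_mul_left (T + 1) h₃) 1)
    gcongr

/-- Functions that are computed by sequential transducers are computable in polynomial time. -/
theorem PolyTime.of_transduce {Q : Type} [Finite Q] [Finite αΓ] [Finite βΓ] {f : α → β}
    (δ : Q → αΓ → Q) (out : Q → αΓ → List βΓ) (fin : Q → List βΓ) (q₀ : Q)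
    (hf : ∀ a, eb (f a) = transduce δ out fin q₀ (ea a)) : PolyTime ea eb f := by
  have := Fintype.ofFinite Q
  have := Fintype.ofFinite αΓ
  let Θ := SumFam (fun _ : Unit => αΓ) (SumFam (fun _ : Unit => βΓ) (fun _ : Unit => βΓ))
  have h₁ := Realizable.scan (Γ := Θ) (.inl ()) id δ
    (fun q a => (out q a).map fun b => ⟨.inr (.inl ()), b⟩)
    (fun q => (fin q).map fun b => ⟨.inr (.inl ()), b⟩) q₀ (by
      intro q a p hp
      obtain ⟨b, -, rfl⟩ := List.mem_map.1 hp
      simp)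
  have h₂ := Realizable.move (Γ := Θ) (k := .inr (.inl ())) (k' := .inr (.inr ())) (by simp) id
  have htr : ∀ q l, transduce δ (fun q a => (out q a).map fun b =>
      (⟨.inr (.inl ()), b⟩ : Σ k, Θ k)) (fun q => (fin q).map fun b => ⟨.inr (.inl ()), b⟩) q l =
      (transduce δ out fin q l).map fun b => ⟨.inr (.inl ()), b⟩ := by
    intro q l
    induction l generalizing q with
    | nil => rfl
    | cons a l ih => simp [transduce, ih]
  obtain ⟨m, hm⟩ : ∃ m, (∀ q a, (out q a).length ≤ m) ∧ ∀ q, (fin q).length ≤ m :=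
    ⟨∑ q, ∑ a, (out q a).length + ∑ q, (fin q).length, fun q a => (Nat.le_add_right_of_le
      ((Finset.single_le_sum (f := fun a => (out q a).length) (fun _ _ => Nat.zero_le _)
        (Finset.mem_univ a)).trans (Finset.single_le_sum (f := fun q => ∑ a, (out q a).length)
          (fun _ _ => Nat.zero_le _) (Finset.mem_univ q)))), fun q => Nat.le_add_left_of_le
      (Finset.single_le_sum (f := fun q => (fin q).length) (fun _ _ => Nat.zero_le _)
        (Finset.mem_univ q))⟩
  have hlen : ∀ q l, (transduce δ out fin q l).length ≤ m * l.length + m := by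
    intro q l
    induction l generalizing q with
    | nil => simpa [transduce] using hm.2 q
    | cons a l ih =>
      have := ih (δ q a)
      have := hm.1 q a
      simp only [transduce, List.length_append, List.length_cons, mul_add, mul_one]
      lia
  refine polyTime_of_realizable (h₁.seq h₂) (.inl ()) (.inr (.inr ())) (Equiv.refl _)
    (Equiv.refl _) ((2 * .X + 1) + (2 * (.C m * .X + .C m) + 1)) fun a => ?_
  let st (u : List αΓ) (v w : List βΓ) : Store Θ := join (stack u) (join (stack v) (stack w))
  refine ⟨st (ea a) [] [], st [] [] (eb (f a)), _,
    .intro (u := st [] (eb (f a)).reverse []) ⟨?_, rfl⟩ ⟨?_, rfl⟩, ?_, ?_, ?_⟩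
  · rw [htr]
    have := pushAll_map (Γ := Θ) (.inr (.inl ())) id (transduce δ out fin q₀ (ea a))
      (st [] [] [])
    have hu : update (st (ea a) [] []) (Sum.inl ()) [] = st [] [] [] := by simp [st, Θ]
    rw [hu]
    refine Eq.trans ?_ ((congrArg (fun l => pushAll l (st [] [] [])) ?_).trans this).symm
    · simp [st, Θ, hf]
    · simp [st]
  · simp [st, Θ]
  · rw [Equiv.refl_symm, Equiv.coe_refl, List.map_id]
    funext k
    rcases k with k | k | k <;> rfl
  · rw [Equiv.refl_symm, Equiv.coe_refl, List.map_id]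
    funext k
    rcases k with k | k | k <;> rfl
  · simp [st]
    rw [hf]
    exact hlen _ _

end Closure
end Ranking

namespace Ranking

open Function

/-! ### Polynomial-time functions between encoded types -/

/-- A type whose elements are written as words over a finite alphabet. -/
class Coded (α : Type) where
  Alphabet : Type
  [finite : Finite Alphabet]
  encode : α → List Alphabet

attribute [instance] Coded.finite

open Coded (encode)

instance : Coded (List Bool) := ⟨Bool, id⟩

instance : Coded Bool := ⟨Bool, Computability.encodeBool⟩

instance {α β : Type} [Coded α] [Coded β] : Coded (α × β) :=
  ⟨Coded.Alphabet α ⊕ Coded.Alphabet β, encodeProd encode encode⟩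

@[simp]
theorem encode_word (l : List Bool) : encode l = l := rfl

@[simp]
theorem encode_bool (b : Bool) : encode b = [b] := rfl

@[simp]
theorem encode_prod {α β : Type} [Coded α] [Coded β] (p : α × β) :
    encode p = (encode p.1).map Sum.inl ++ (encode p.2).map Sum.inr := rfl

section FP

variable {α β γ δ : Type} [Coded α] [Coded β] [Coded γ] [Coded δ]

/-- Functions computable in polynomial time with respect to the standard encodings. -/
def FP (f : α → β) : Prop := PolyTime (encode : α → _) (encode : β → _) f

theorem FP.comp {f : α → β} {g : β → γ} (hg : FP g) (hf : FP f) : FP fun a => g (f a) :=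
  PolyTime.comp hg hf

theorem FP.pair {f : α → β} {g : α → γ} (hf : FP f) (hg : FP g) : FP fun a => (f a, g a) :=
  PolyTime.pair hf hg

/-- Growth by at most one letter per round keeps lengths within the initial length plus the number
of rounds, so `X` is a valid bound. -/
theorem FP.iterate {h : α → α} (hh : FP h) {c : γ → Word} (hc : FP c) {d : γ → α} (hd : FP d)
    (hlen : ∀ a, (encode (h a)).length ≤ (encode a).length + 1) :
    FP fun x => h^[(c x).length] (d x) := by
  refine FP.comp (g := fun x : Word × α => h^[x.1.length] x.2)
    (PolyTime.iterate hh .X fun a n => ?_) (hc.pair hd)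
  rw [Polynomial.eval_X]
  induction n generalizing a with
  | zero => rfl
  | succ n ih =>
    have h₁ := ih (h a)
    have h₂ := hlen a
    rw [iterate_succ_apply]
    lia

theorem transduce_append {Q A B : Type} {tr : Q → A → Q} {out : Q → A → List B} {fin : Q → List B}
    {q : Q} {l : List A} (h : ∀ a ∈ l, tr q a = q) (l' : List A) :
    transduce tr out fin q (l ++ l') = l.flatMap (out q) ++ transduce tr out fin q l' := by
  induction l with
  | nil => rfl
  | cons a l ih =>
    rw [List.cons_append, transduce, h a (by simp), ih fun a' ha' => h a' (by simp [ha'])]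
    simp

theorem transduce_of_stable {Q A B : Type} {tr : Q → A → Q} {out : Q → A → List B}
    {fin : Q → List B} {q : Q} {l : List A} (h : ∀ a ∈ l, tr q a = q) :
    transduce tr out fin q l = l.flatMap (out q) ++ fin q := by
  simpa [transduce] using transduce_append (out := out) (fin := fin) h []

theorem FP.of_flatMap {f : α → β} (out : Coded.Alphabet α → List (Coded.Alphabet β))
    (hf : ∀ a, encode (f a) = (encode a).flatMap out) : FP f :=
  PolyTime.of_transduce (Q := Unit) (fun _ _ => ()) (fun _ => out) (fun _ => []) () fun a => by
    rw [transduce_of_stable (by simp), hf, List.append_nil]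

theorem FP.id : FP fun a : α => a := .of_flatMap (fun a => [a]) (by simp)

theorem FP.const (b : β) : FP fun _ : α => b :=
  PolyTime.of_transduce (Q := Unit) (fun _ _ => ()) (fun _ _ => []) (fun _ => encode b) ()
    fun a => by rw [transduce_of_stable (by simp)]; simp

theorem FP.fst {f : α → β × γ} (hf : FP f) : FP fun a => (f a).1 :=
  FP.comp (g := fun p : β × γ => p.1)
    (.of_flatMap (Sum.elim (fun a => [a]) fun _ => []) (by simp [List.flatMap_map])) hf

theorem FP.snd {f : α → β × γ} (hf : FP f) : FP fun a => (f a).2 :=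
  FP.comp (g := fun p : β × γ => p.2)
    (.of_flatMap (Sum.elim (fun _ => []) fun a => [a]) (by simp [List.flatMap_map])) hf

theorem FP.cons {b : α → Bool} {f : α → Word} (hb : FP b) (hf : FP f) : FP fun a => b a :: f a :=
  FP.comp (g := fun p : Bool × Word => p.1 :: p.2)
    (.of_flatMap (Sum.elim (fun a => [a]) fun a => [a]) (by simp [List.flatMap_map]))
    (hb.pair hf)

/-- Both branches are computed; a transducer remembers the leading Boolean and erases the unwanted
result. -/
theorem FP.cond {c : α → Bool} {f g : α → β} (hc : FP c) (hf : FP f) (hg : FP g) :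
    FP fun a => bif c a then f a else g a := by
  refine FP.comp (g := fun p : Bool × (β × β) => bif p.1 then p.2.1 else p.2.2) ?_
    (hc.pair (hf.pair hg))
  refine PolyTime.of_transduce (Q := Option Bool)
    (fun q s => s.elim (fun b => some b) fun _ => q)
    (fun q s => s.elim (fun _ => []) fun s => s.elim (fun x => if q = some true then [x] else [])
      fun x => if q = some true then [] else [x]) (fun _ => []) none ?_
  rintro ⟨b, x, y⟩
  rw [encode_prod, encode_bool, List.map_singleton, List.singleton_append, transduce, Sum.elim_inl,
    Sum.elim_inl, transduce_of_stable (by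
      simp only [encode_prod, List.mem_map]; rintro _ ⟨z, -, rfl⟩; rfl)]
  cases b <;> simp [List.flatMap_map]

theorem FP.and {c d : α → Bool} (hc : FP c) (hd : FP d) : FP fun a => c a && d a := by
  have : (fun a => c a && d a) = fun a => bif c a then d a else false := by
    funext a; cases c a <;> rfl
  rw [this]
  exact hc.cond hd (.const false)

theorem FP.not {c : α → Bool} (hc : FP c) : FP fun a => !c a := by
  have : (fun a => !c a) = fun a => bif c a then false else true := by
    funext a; cases c a <;> rfl
  rw [this]
  exact hc.cond (.const false) (.const true)

/-! ### Operations on words -/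

theorem FP.isEmpty {f : α → Word} (hf : FP f) : FP fun a => (f a).isEmpty :=
  FP.comp (g := fun l : Word => l.isEmpty) (PolyTime.of_transduce (Q := Bool) (fun _ _ => false)
    (fun _ _ => []) (fun q => [q]) true fun l => by
      cases l with
      | nil => rfl
      | cons a l => rw [encode_word, transduce, transduce_of_stable (by simp)]; simp) hf

theorem FP.headD {f : α → Word} (hf : FP f) : FP fun a => (f a).headD false :=
  FP.comp (g := fun l : Word => l.headD false) (PolyTime.of_transduce (Q := Option Bool)
    (fun q a => some (q.getD a)) (fun _ _ => []) (fun q => [q.getD false]) none fun l => by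
      cases l with
      | nil => rfl
      | cons a l => rw [encode_word, transduce, transduce_of_stable (by simp)]; simp) hf

theorem FP.tail {f : α → Word} (hf : FP f) : FP fun a => (f a).tail :=
  FP.comp (g := fun l : Word => l.tail) (PolyTime.of_transduce (Q := Bool)
    (fun _ _ => true) (fun q a => if q then [a] else []) (fun _ => []) false fun l => by
      cases l with
      | nil => rfl
      | cons a l =>
        rw [encode_word, encode_word, transduce, transduce_of_stable (by simp)]
        simp) hf

theorem iterate_tail {A : Type*} (n : ℕ) (l : List A) : List.tail^[n] l = l.drop n := by
  induction n generalizing l with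
  | zero => rfl
  | succ n ih => rw [iterate_succ_apply, ih, List.drop_tail]

theorem FP.drop {f g : α → Word} (hf : FP f) (hg : FP g) :
    FP fun a => (g a).drop (f a).length := by
  have := FP.iterate (h := List.tail) (FP.tail .id) hf hg fun l => by
    simp
    lia
  simpa only [iterate_tail] using this

/-- The successor of a binary number, the least significant digit coming first. -/
def binSucc : Word → Word
  | [] => [true]
  | false :: l => true :: l
  | true :: l => false :: binSucc l

/-- The state of the transducer is the carry. -/
theorem FP.binSucc {f : α → Word} (hf : FP f) : FP fun a => binSucc (f a) := by
  refine FP.comp (g := Ranking.binSucc) (PolyTime.of_transduce (Q := Bool)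
    (fun q a => q && a) (fun q a => [q ^^ a]) (fun q => if q then [true] else []) true
    fun l => ?_) hf
  rw [encode_word, encode_word]
  induction l with
  | nil => rfl
  | cons a l ih =>
    cases a
    · rw [transduce, transduce_of_stable (by simp)]
      simp [Ranking.binSucc]
    · rw [transduce, Ranking.binSucc, ih]
      rfl

/-- A pair of words as a single word. -/
def packWords (l l' : Word) : Word :=
  l.flatMap (fun a => [false, a]) ++ l'.flatMap fun a => [true, a]

theorem length_packWords (l l' : Word) :
    (packWords l l').length = 2 * l.length + 2 * l'.length := by
  simp [packWords, mul_comm]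

theorem FP.packWords {f g : α → Word} (hf : FP f) (hg : FP g) :
    FP fun a => packWords (f a) (g a) :=
  FP.comp (g := fun p : Word × Word => Ranking.packWords p.1 p.2)
    (.of_flatMap (Sum.elim (fun a => [false, a]) fun a => [true, a])
      (by simp [List.flatMap_map, Ranking.packWords]; intros; rfl)) (hf.pair hg)

/-- The word consisting of the letters at odd positions that follow the letter `t`. -/
def unpackWord (t : Bool) : Word → Word
  | s :: a :: l => if s = t then a :: unpackWord t l else unpackWord t l
  | _ => []

theorem unpackWord_packWords (t : Bool) (l l' : Word) :
    unpackWord t (packWords l l') = if t then l' else l := by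
  have h₁ : ∀ l : Word, unpackWord t (l.flatMap fun a => [true, a]) = if t then l else [] := by
    intro l
    induction l with
    | nil => cases t <;> rfl
    | cons a l ih =>
      rw [List.flatMap_cons, List.cons_append, List.singleton_append, unpackWord, ih]
      cases t <;> simp
  induction l with
  | nil => simp [packWords, h₁]
  | cons a l ih =>
    rw [packWords, List.flatMap_cons, List.append_assoc, List.cons_append, List.singleton_append,
      unpackWord]
    rw [packWords] at ih
    rw [ih]
    cases t <;> simp

theorem length_unpackWord_le (t : Bool) : ∀ l : Word, (unpackWord t l).length ≤ l.length
  | s :: a :: l => by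
    have := length_unpackWord_le t l
    rw [unpackWord]
    split <;> simp <;> lia
  | [] => by simp [unpackWord]
  | [a] => by simp [unpackWord]

theorem FP.unpackWord (t : Bool) {f : α → Word} (hf : FP f) : FP fun a => unpackWord t (f a) := by
  refine FP.comp (g := Ranking.unpackWord t) (PolyTime.of_transduce (Q := Option Bool)
    (fun q a => q.elim (some a) fun _ => none)
    (fun q a => q.elim [] fun s => if s = t then [a] else []) (fun _ => []) none fun l => ?_) hf
  rw [encode_word, encode_word]
  induction l using Ranking.unpackWord.induct t with
  | case1 a l ih => simp [transduce, Ranking.unpackWord, ih]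
  | case2 s a l h ih => simp [transduce, Ranking.unpackWord, ih, h]
  | case3 l h =>
    match l with
    | [] => rfl
    | [a] => rfl
    | s :: a :: l => exact (h s a l rfl).elim

/-! ### Comparison of words -/

/-- One step of the comparison of two words in the order by length and lexicographic order; the last
component is empty as long as the words agree, and otherwise `true` if the first word is larger. -/
def compareStep (p : (Word × Word) × Word) : (Word × Word) × Word :=
  ((p.1.1.tail, p.1.2.tail),
    bif p.1.1.isEmpty then bif p.1.2.isEmpty then p.2 else [false]
    else bif p.1.2.isEmpty then [true]
    else bif p.2.isEmpty then
      bif p.1.1.headD false then bif p.1.2.headD false then [] else [true]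
      else bif p.1.2.headD false then [false] else []
    else p.2)

/-- Compare two words in the order by length and lexicographic order. -/
def compareWords (l l' : Word) : Word :=
  (compareStep^[(packWords l l').length] ((l, l'), [])).2

/-- The packed word serves only as a clock that is long enough for both words. -/
theorem FP.compareWords {f g : α → Word} (hf : FP f) (hg : FP g) :
    FP fun a => compareWords (f a) (g a) := by
  have h : FP compareStep := by
    have h₁ : FP fun p : (Word × Word) × Word => p.1.1 := .fst (.fst .id)
    have h₂ : FP fun p : (Word × Word) × Word => p.1.2 := .snd (.fst .id)
    have h₃ : FP fun p : (Word × Word) × Word => p.2 := .snd .id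
    exact (h₁.tail.pair h₂.tail).pair (h₁.isEmpty.cond (h₂.isEmpty.cond h₃ (.const _))
      (h₂.isEmpty.cond (.const _) (h₃.isEmpty.cond (h₁.headD.cond
        (h₂.headD.cond (.const _) (.const _)) (h₂.headD.cond (.const _) (.const _))) h₃)))
  refine .snd (.iterate h (hf.packWords hg) ((hf.pair hg).pair (.const [])) fun p => ?_)
  obtain ⟨⟨l, l'⟩, c⟩ := p
  rcases l with _ | ⟨_ | _, l⟩ <;> rcases l' with _ | ⟨_ | _, l'⟩ <;> rcases c with _ | ⟨a, c⟩ <;>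
    simp [compareStep] <;> lia

end FP

end Ranking

namespace Ranking

open Function

/-! ### The position of a word in the enumeration of all words -/

/-- The number with the binary digits of `a` followed by those in the word. -/
def appendDigits : ℕ → Word → ℕ
  | a, [] => a
  | a, b :: l => appendDigits (2 * a + b.toNat) l

theorem le_appendDigits (a : ℕ) (l : Word) : a * 2 ^ l.length ≤ appendDigits a l := by
  induction l generalizing a with
  | nil => simp [appendDigits]
  | cons b l ih =>
    refine le_trans ?_ (ih _)
    rw [List.length_cons, pow_succ', ← mul_assoc]
    gcongr
    lia

theorem appendDigits_lt (a : ℕ) (l : Word) : appendDigits a l < (a + 1) * 2 ^ l.length := by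
  induction l generalizing a with
  | nil => simp [appendDigits]
  | cons b l ih =>
    refine lt_of_lt_of_le (ih _) ?_
    rw [List.length_cons, pow_succ', ← mul_assoc]
    gcongr
    have := b.toNat_le
    lia

/-- For words of length `n`, the values lie in the disjoint intervals `[a * 2 ^ n, (a + 1) * 2 ^ n)`
and `[b * 2 ^ n, (b + 1) * 2 ^ n)`. -/
theorem appendDigits_lt_appendDigits {a b : ℕ} (h : a < b) {l l' : Word}
    (hl : l.length = l'.length) : appendDigits a l < appendDigits b l' :=
  (appendDigits_lt a l).trans_le
    ((Nat.mul_le_mul_right _ h).trans (hl ▸ le_appendDigits b l'))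

theorem appendDigits_lt_iff_lex (a : ℕ) {l l' : Word} (h : l.length = l'.length) :
    appendDigits a l < appendDigits a l' ↔ List.Lex (· < ·) l l' := by
  induction l generalizing a l' with
  | nil =>
    obtain rfl := List.length_eq_zero_iff.1 h.symm
    simp
  | cons x l ih =>
    obtain _ | ⟨y, l'⟩ := l'
    · simp at h
    have h' : l.length = l'.length := by simpa using h
    rw [List.cons_lex_cons_iff]
    rcases lt_trichotomy x y with hxy | rfl | hxy
    · refine iff_of_true (appendDigits_lt_appendDigits (l := l) (l' := l') ?_ h') (.inl hxy)
      obtain ⟨rfl, rfl⟩ := Bool.lt_iff.1 hxy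
      simp
    · rw [appendDigits, appendDigits, ih _ h']
      simp
    · refine iff_of_false (appendDigits_lt_appendDigits (l := l') (l' := l) ?_ h'.symm).not_gt ?_
      · obtain ⟨rfl, rfl⟩ := Bool.lt_iff.1 hxy
        simp
      · rintro (h | ⟨rfl, -⟩)
        exacts [h.not_gt hxy, hxy.ne rfl]

/-- The position of a word in the enumeration of all words, starting with `1`. -/
def position (l : Word) : ℕ := appendDigits 1 l

theorem one_le_position (l : Word) : 1 ≤ position l := by
  have := le_appendDigits 1 l
  rw [one_mul] at this
  exact Nat.one_le_two_pow.trans this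

/-- The leading digit `1` puts the words of length `n` into `[2 ^ n, 2 ^ (n + 1))`. -/
theorem position_lt_of_length_lt {l l' : Word} (h : l.length < l'.length) :
    position l < position l' :=
  calc position l < 2 * 2 ^ l.length := appendDigits_lt 1 l
    _ = 2 ^ (l.length + 1) := (pow_succ' ..).symm
    _ ≤ 2 ^ l'.length := Nat.pow_le_pow_right two_pos h
    _ ≤ position l' := by simpa [position] using le_appendDigits 1 l'

theorem length_le_of_position_le {l l' : Word} (h : position l ≤ position l') :
    l.length ≤ l'.length :=
  not_lt.1 fun hl => (position_lt_of_length_lt hl).not_ge h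

theorem shortlex_iff {l l' : Word} :
    List.Shortlex (· < ·) l l' ↔ position l < position l' := by
  rw [List.shortlex_def]
  rcases lt_trichotomy l.length l'.length with h | h | h
  · exact iff_of_true (.inl h) (position_lt_of_length_lt h)
  · rw [position, position, appendDigits_lt_iff_lex 1 h]
    simp [h]
  · refine iff_of_false ?_ (position_lt_of_length_lt h).not_gt
    rintro (h' | ⟨h', -⟩) <;> lia

theorem position_injective : Injective position := by
  intro l l' h
  have hl : l.length = l'.length :=
    le_antisymm (length_le_of_position_le h.le) (length_le_of_position_le h.ge)
  have key : ∀ (a b : ℕ) (l l' : Word), l.length = l'.length →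
      appendDigits a l = appendDigits b l' → a = b ∧ l = l' := by
    intro a b l
    induction l generalizing a b with
    | nil =>
      intro l' hl h
      obtain rfl := List.length_eq_zero_iff.1 hl.symm
      exact ⟨h, rfl⟩
    | cons x l ih =>
      intro l' hl h
      obtain _ | ⟨y, l'⟩ := l'
      · simp at hl
      obtain ⟨h, rfl⟩ := ih _ _ l' (by simpa using hl) h
      have hx := x.toNat_le
      have hy := y.toNat_le
      obtain ⟨h, h'⟩ : a = b ∧ x.toNat = y.toNat := by lia
      refine ⟨h, ?_⟩
      cases x <;> cases y <;> simp at h' ⊢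
  exact (key 1 1 l l' hl h).2

theorem wordLE_iff {l l' : Word} : WordLE l l' ↔ position l ≤ position l' := by
  rw [WordLE, shortlex_iff, le_iff_eq_or_lt, position_injective.eq_iff]

/-- The word expressing the result of the comparison of two numbers. -/
def comparisonWord (a b : ℕ) : Word :=
  if a < b then [false] else if b < a then [true] else []

theorem compareStep_iterate_of_nil_left (n : ℕ) (l : Word) :
    (compareStep^[n] (([], l), [false])).2 = [false] := by
  induction n generalizing l with
  | zero => rfl
  | succ n ih =>
    rw [iterate_succ_apply]
    convert ih l.tail using 3
    cases l <;> rfl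

theorem compareStep_iterate_of_nil_right (n : ℕ) (l : Word) :
    (compareStep^[n] ((l, []), [true])).2 = [true] := by
  induction n generalizing l with
  | zero => rfl
  | succ n ih =>
    rw [iterate_succ_apply]
    convert ih l.tail using 3
    cases l <;> rfl

/-- The invariant: `a` and `b` are the numbers read so far, both with `m + 1` digits, and the
verdict compares them. If one word ends first, the other number is longer and wins regardless of the
verdict; otherwise new digits matter only if `a = b`. -/
theorem compareStep_iterate (n : ℕ) (l l' : Word) (a b m : ℕ) (hl : l.length ≤ n)
    (hl' : l'.length ≤ n) (ha : 2 ^ m ≤ a) (ha' : a < 2 ^ (m + 1)) (hb : 2 ^ m ≤ b)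
    (hb' : b < 2 ^ (m + 1)) :
    (compareStep^[n] ((l, l'), comparisonWord a b)).2 =
      comparisonWord (appendDigits a l) (appendDigits b l') := by
  induction n generalizing l l' a b m with
  | zero =>
    obtain rfl := List.length_eq_zero_iff.1 (Nat.le_zero.1 hl)
    obtain rfl := List.length_eq_zero_iff.1 (Nat.le_zero.1 hl')
    rfl
  | succ n ih =>
    rw [iterate_succ_apply]
    have hm : 2 ^ (m + 1) = 2 * 2 ^ m := pow_succ' ..
    have hm' : 2 ^ (m + 1 + 1) = 2 * 2 ^ (m + 1) := pow_succ' ..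
    rcases l with _ | ⟨x, l⟩ <;> rcases l' with _ | ⟨y, l'⟩
    · exact ih [] [] a b m (Nat.zero_le _) (Nat.zero_le _) ha ha' hb hb'
    · refine (compareStep_iterate_of_nil_left n l').trans ?_
      have h := le_appendDigits b (y :: l')
      have h' : 2 ≤ 2 ^ (y :: l').length := by
        rw [List.length_cons, pow_succ']; have := Nat.one_le_two_pow (n := l'.length); lia
      have : a < appendDigits b (y :: l') := by nlinarith
      exact (if_pos this).symm
    · refine (compareStep_iterate_of_nil_right n l).trans ?_
      have h := le_appendDigits a (x :: l)
      have h' : 2 ≤ 2 ^ (x :: l).length := by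
        rw [List.length_cons, pow_succ']; have := Nat.one_le_two_pow (n := l.length); lia
      have : b < appendDigits a (x :: l) := by nlinarith
      exact ((if_neg this.not_gt).trans (if_pos this)).symm
    · have hx := x.toNat_le
      have hy := y.toNat_le
      refine Eq.trans ?_ (ih l l' (2 * a + x.toNat) (2 * b + y.toNat) (m + 1)
        (by simpa using hl) (by simpa using hl') (by lia) (by lia) (by lia) (by lia))
      congr 2
      rw [compareStep]
      congr 1
      rcases lt_trichotomy a b with h | rfl | h
      · rw [comparisonWord, comparisonWord, if_pos h, if_pos (by lia)]; rfl
      · cases x <;> cases y <;> simp [comparisonWord]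
      · rw [comparisonWord, comparisonWord, if_neg h.not_gt, if_pos h, if_neg (by lia),
          if_pos (by lia)]
        rfl

theorem compareWords_eq (l l' : Word) :
    compareWords l l' = comparisonWord (position l) (position l') := by
  have h := length_packWords l l'
  have := compareStep_iterate (packWords l l').length l l' 1 1 0 (by lia) (by lia) (by simp)
    (by simp) (by simp) (by simp)
  exact this

theorem compareWords_eq_nil_iff {l l' : Word} : (compareWords l l').isEmpty = true ↔ l = l' := by
  rw [compareWords_eq, comparisonWord, ← position_injective.eq_iff]
  split_ifs <;> simp <;> lia

theorem headD_compareWords_iff {l l' : Word} :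
    (compareWords l l').headD false = true ↔ position l' < position l := by
  rw [compareWords_eq, comparisonWord]
  split_ifs <;> simp <;> lia

/-! ### Binary numbers -/

theorem encodeNat_zero : Computability.encodeNat 0 = [] := rfl

/-- The condition `h` rules out a leading zero. -/
theorem encodeNat_bit (b : Bool) (n : ℕ) (h : n = 0 → b = true) :
    Computability.encodeNat (Nat.bit b n) = b :: Computability.encodeNat n := by
  have h₁ : ((Nat.bit b n : ℕ) : Num) = if b then (n : Num).bit1 else (n : Num).bit0 := by
    cases b
    · rw [if_neg (by simp), Nat.bit_val, Bool.toNat_false, add_zero, two_mul,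
        Nat.cast_add, Num.bit0_of_bit0]
    · rw [if_pos rfl, Nat.bit_val, Bool.toNat_true, two_mul, Nat.cast_add,
        Nat.cast_add, Nat.cast_one, Num.bit1_of_bit1]
  have h₂ : (n : Num) = 0 → n = 0 := by
    intro h; simpa using h
  rw [Computability.encodeNat, Computability.encodeNat, h₁]
  revert h₂
  cases hn : (n : Num) with
  | zero =>
    intro h₂
    obtain rfl := h (h₂ rfl)
    rfl
  | pos n => intro _; cases b <;> rfl

theorem binSucc_encodeNat (n : ℕ) :
    binSucc (Computability.encodeNat n) = Computability.encodeNat (n + 1) := by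
  induction n using Nat.binaryRec' with
  | zero => rfl
  | bit b n h ih =>
    rw [encodeNat_bit b n h]
    cases b
    · have : Nat.bit false n + 1 = Nat.bit true n := by simp [Nat.bit_val]
      rw [this, encodeNat_bit true n fun _ => rfl]
      rfl
    · have : Nat.bit true n + 1 = Nat.bit false (n + 1) := by simp [Nat.bit_val]; lia
      rw [this, encodeNat_bit false (n + 1) (by simp), binSucc, ih]

theorem encodeNat_injective : Injective Computability.encodeNat := fun m n h => by
  rw [← Computability.decode_encodeNat m, h, Computability.decode_encodeNat]

/-- Beyond the last digit the default `false` agrees with `testBit`. -/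
theorem headD_drop_encodeNat (n i : ℕ) :
    ((Computability.encodeNat n).drop i).headD false = n.testBit i := by
  induction n using Nat.binaryRec' generalizing i with
  | zero => simp [encodeNat_zero]
  | bit b n h ih =>
    rw [encodeNat_bit b n h]
    cases i with
    | zero => simp
    | succ i => rw [List.drop_succ_cons, ih, Nat.testBit_bit_succ]

end Ranking

namespace Ranking

open Function

/-! ### Ranks -/

section Rank

variable (A : Set Word)

/-- Finiteness makes `ncard` in the definition of `rank` a genuine count. -/
theorem finite_setOf_wordLE (y : Word) : {z | WordLE z y ∧ z ∈ A}.Finite :=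
  ((Set.finite_Iic (position y)).preimage position_injective.injOn).subset
    fun _ hz => wordLE_iff.1 hz.1

variable {A}

theorem rank_mono {x y : Word} (h : position x ≤ position y) : rank A x ≤ rank A y :=
  Set.ncard_le_ncard (fun _ hz => ⟨wordLE_iff.2 ((wordLE_iff.1 hz.1).trans h), hz.2⟩)
    (finite_setOf_wordLE A y)

theorem rank_lt_rank {x y : Word} (h : position x < position y) (hy : y ∈ A) :
    rank A x < rank A y := by
  refine Set.ncard_lt_ncard ⟨fun z hz => ⟨wordLE_iff.2 ((wordLE_iff.1 hz.1).trans h.le), hz.2⟩,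
    fun hs => ?_⟩ (finite_setOf_wordLE A y)
  exact (wordLE_iff.1 (hs ⟨wordLE_iff.2 le_rfl, hy⟩).1).not_gt h

theorem rank_pos {y : Word} (hy : y ∈ A) : 0 < rank A y :=
  (Set.ncard_pos (finite_setOf_wordLE A y)).2 ⟨y, wordLE_iff.2 le_rfl, hy⟩

theorem rank_injOn : Set.InjOn (rank A) A := by
  intro x hx y hy h
  rcases lt_trichotomy (position x) (position y) with h' | h' | h'
  · exact absurd h (rank_lt_rank h' hy).ne
  · exact position_injective h'
  · exact absurd h (rank_lt_rank h' hx).ne'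

/-- The words counted have distinct positions between `1` and `position x`. This limits the number
of digits to be queried. -/
theorem rank_lt_two_pow (x : Word) : rank A x < 2 ^ (x.length + 1) := by
  have h₁ : rank A x ≤ position x := by
    rw [rank, ← Set.ncard_image_of_injective _ position_injective]
    refine (Set.ncard_le_ncard (t := Finset.Icc 1 (position x)) ?_).trans ?_
    · rintro _ ⟨z, hz, rfl⟩
      simp only [Finset.coe_Icc, Set.mem_Icc]
      exact ⟨one_le_position z, wordLE_iff.1 hz.1⟩
    · rw [Set.ncard_coe_finset, Nat.card_Icc, Nat.add_sub_cancel]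
  have h₂ := appendDigits_lt 1 x
  rw [pow_succ']
  exact h₁.trans_lt h₂

theorem exists_rank_eq {x : Word} (h : rank A x ≠ 0) :
    ∃ z ∈ A, position z ≤ position x ∧ rank A z = rank A x := by
  have hne : {z | WordLE z x ∧ z ∈ A}.Nonempty := Set.nonempty_of_ncard_ne_zero h
  obtain ⟨z, ⟨hz, hzA⟩, hmax⟩ := (finite_setOf_wordLE A x).exists_maximalFor position _ hne
  rw [wordLE_iff] at hz
  refine ⟨z, hzA, hz, le_antisymm (rank_mono hz) (Set.ncard_le_ncard ?_ (finite_setOf_wordLE A z))⟩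
  intro y hy
  refine ⟨wordLE_iff.2 ?_, hy.2⟩
  by_contra hyz
  exact hyz (hmax hy (le_of_not_ge hyz))

theorem exists_rank_eq_succ {x y : Word} (hxy : position x < position y) (hy : y ∈ A) :
    ∃ z ∈ A, position x < position z ∧ position z ≤ position y ∧ rank A z = rank A x + 1 := by
  have hfin : {z | position x < position z ∧ WordLE z y ∧ z ∈ A}.Finite :=
    (finite_setOf_wordLE A y).subset fun _ hz => hz.2
  obtain ⟨z, ⟨hxz, hzy, hzA⟩, hmin⟩ :=
    hfin.exists_minimalFor position _ ⟨y, hxy, wordLE_iff.2 le_rfl, hy⟩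
  refine ⟨z, hzA, hxz, wordLE_iff.1 hzy, ?_⟩
  have : {w | WordLE w z ∧ w ∈ A} = insert z {w | WordLE w x ∧ w ∈ A} := by
    ext w
    simp only [Set.mem_ofPred_eq, Set.mem_insert_iff, wordLE_iff]
    constructor
    · rintro ⟨hwz, hw⟩
      by_contra! hcon
      have hxw : position x < position w := lt_of_not_ge fun h => hcon.2 h hw
      have := hmin ⟨hxw, wordLE_iff.2 (hwz.trans (wordLE_iff.1 hzy)), hw⟩ hwz
      exact hcon.1 (position_injective (le_antisymm hwz this))
    · rintro (rfl | ⟨h, hw⟩)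
      · exact ⟨le_rfl, hzA⟩
      · exact ⟨h.trans hxz.le, hw⟩
  rw [rank, this, Set.ncard_insert_of_notMem _ (finite_setOf_wordLE A x), rank]
  exact fun h => (wordLE_iff.1 h.1).not_gt hxz

/-- The elements of `A` around `x`: `y` is the first element after `x`, and `u` is the word
`true :: z` for the last element `z` not after `x`, or empty if there is none. -/
def IsBracket (A : Set Word) (x u y : Word) : Prop :=
  (u = [] ∧ rank A x = 0 ∨
    ∃ z ∈ A, u = true :: z ∧ position z ≤ position x ∧ rank A z = rank A x) ∧
  y ∈ A ∧ position x < position y ∧ rank A y = rank A x + 1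

/-- The rank of `x` prescribes the ranks of both ends, and an element of `A` is determined by its
rank. Elements have positive rank, so an absent lower end cannot be confused with a present one. -/
theorem IsBracket.unique {x u u' y y' : Word} (h : IsBracket A x u y) (h' : IsBracket A x u' y') :
    u = u' ∧ y = y' := by
  obtain ⟨h₁, h₂, -, h₃⟩ := h
  obtain ⟨h₁', h₂', -, h₃'⟩ := h'
  refine ⟨?_, rank_injOn h₂ h₂' (h₃.trans h₃'.symm)⟩
  rcases h₁ with ⟨rfl, h₁⟩ | ⟨z, hz, rfl, -, h₁⟩ <;>
    rcases h₁' with ⟨rfl, h₁'⟩ | ⟨z', hz', rfl, -, h₁'⟩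
  · rfl
  · exact absurd (rank_pos hz') (by lia)
  · exact absurd (rank_pos hz) (by lia)
  · rw [rank_injOn hz hz' (h₁.trans h₁'.symm)]

theorem exists_isBracket {x y : Word} (hxy : position x < position y) (hy : y ∈ A) :
    ∃ u z, IsBracket A x u z ∧ u.length ≤ x.length + 1 ∧ z.length ≤ y.length := by
  obtain ⟨z, hzA, hxz, hzy, hz⟩ := exists_rank_eq_succ hxy hy
  by_cases h : rank A x = 0
  · exact ⟨[], z, ⟨.inl ⟨rfl, h⟩, hzA, hxz, hz⟩, Nat.zero_le _, length_le_of_position_le hzy⟩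
  · obtain ⟨w, hw, hwx, hwr⟩ := exists_rank_eq h
    exact ⟨true :: w, z, ⟨.inr ⟨w, hw, rfl, hwx, hwr⟩, hzA, hxz, hz⟩,
      by simpa using length_le_of_position_le hwx, length_le_of_position_le hzy⟩

end Rank

/-! ### Certificates -/

section Certificate

variable (F : Word → Word)

/-- The rank of the lower end of a bracket in binary, `F` being the semistrong ranking function. -/
def lowerRank (u : Word) : Word := bif u.isEmpty then [] else (F u.tail).tail

/-- Check that `w` encodes the elements of `A` around `x`. -/
def checkBracket (x w : Word) : Bool :=
  (compareWords w (packWords (unpackWord false w) (unpackWord true w))).isEmpty &&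
  ((bif (unpackWord false w).isEmpty then true else
    (unpackWord false w).headD false && !(F (unpackWord false w).tail).isEmpty) &&
  (!(compareWords (unpackWord false w).tail x).headD false &&
  ((compareWords (unpackWord true w) x).headD false &&
  (compareWords (F (unpackWord true w))
    (true :: binSucc (lowerRank F (unpackWord false w)))).isEmpty)))

variable {F} {α : Type} [Coded α]

theorem FP.lowerRank (hF : FP F) {f : α → Word} (hf : FP f) : FP fun a => lowerRank F (f a) :=
  hf.isEmpty.cond (.const []) (hF.comp hf.tail).tail

theorem FP.checkBracket (hF : FP F) {f g : α → Word} (hf : FP f) (hg : FP g) :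
    FP fun a => checkBracket F (f a) (g a) := by
  have hu := hg.unpackWord false
  have hy := hg.unpackWord true
  exact (hg.compareWords (hu.packWords hy)).isEmpty.and
    ((hu.isEmpty.cond (.const true) (hu.headD.and (hF.comp hu.tail).isEmpty.not)).and
    ((hu.tail.compareWords hf).headD.not.and
    ((hy.compareWords hf).headD.and
    ((hF.comp hy).compareWords ((FP.const true).cons (hF.lowerRank hu).binSucc)).isEmpty)))

variable {A : Set Word}

theorem IsBracket.lowerRank_eq
    (hFA : ∀ x ∈ A, F x = true :: Computability.encodeNat (rank A x)) {x u y : Word}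
    (h : IsBracket A x u y) :
    lowerRank F u = Computability.encodeNat (rank A x) := by
  obtain ⟨⟨rfl, h⟩ | ⟨z, hz, rfl, -, h⟩, -⟩ := h
  · rw [h]; rfl
  · simp [lowerRank, hFA z hz, h]

/-- If `z ≤ x < y` with `y` in `A`, then `rank z ≤ rank x < rank y`, so `rank y = rank z + 1` forces
`rank x = rank z`. Repacking the unpacked parts and comparing with `w` excludes other words that
unpack to the same pair, which would spoil uniqueness of certificates. -/
theorem checkBracket_iff
    (hFA : ∀ x ∈ A, F x = true :: Computability.encodeNat (rank A x))
    (hFA' : ∀ x, x ∉ A → F x = []) {x w : Word} :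
    checkBracket F x w = true ↔ ∃ u y, w = packWords u y ∧ IsBracket A x u y := by
  constructor
  · intro h
    simp only [checkBracket, Bool.and_eq_true, compareWords_eq_nil_iff, headD_compareWords_iff,
      Bool.not_eq_true', ← Bool.not_eq_true] at h
    obtain ⟨hw, hu, hux, hxy, hy⟩ := h
    generalize unpackWord false w = u at *
    generalize unpackWord true w = y at *
    refine ⟨u, y, hw, ?_⟩
    have hyA : y ∈ A := by
      by_contra hyA
      simp [hFA' y hyA] at hy
    have hr := rank_lt_rank hxy hyA
    rw [hFA y hyA, List.cons.injEq] at hy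
    cases u with
    | nil =>
      -- An absent lower end counts as rank `0`, so `y` is the first element of `A`.
      have : rank A y = 1 := encodeNat_injective hy.2
      exact ⟨.inl ⟨rfl, by lia⟩, hyA, hxy, by lia⟩
    | cons a z =>
      simp only [List.isEmpty_cons, cond_false, List.headD_cons, List.tail_cons,
        Bool.and_eq_true, Bool.not_eq_true', not_lt] at hu hux
      obtain ⟨rfl, hz⟩ := hu
      have hzA : z ∈ A := by
        by_contra hzA
        simp [hFA' z hzA] at hz
      have h₁ := rank_mono (A := A) hux
      have h₂ : rank A y = rank A z + 1 := by
        refine encodeNat_injective (hy.2.trans ?_)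
        simp [lowerRank, hFA z hzA, binSucc_encodeNat]
      exact ⟨.inr ⟨z, hzA, rfl, hux, by lia⟩, hyA, hxy, by lia⟩
  · rintro ⟨u, y, rfl, h⟩
    have hl := h.lowerRank_eq hFA
    simp only [checkBracket, Bool.and_eq_true, compareWords_eq_nil_iff, headD_compareWords_iff,
      Bool.not_eq_true', ← Bool.not_eq_true, unpackWord_packWords, if_true, Bool.false_eq_true,
      if_false, hl, binSucc_encodeNat]
    obtain ⟨hu, hy, hxy, hr⟩ := h
    refine ⟨trivial, ?_, ?_, hxy, by rw [hFA y hy, hr]⟩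
    · rcases hu with ⟨rfl, -⟩ | ⟨z, hz, rfl, -⟩
      · rfl
      · simp [hFA z hz]
    · rcases hu with ⟨rfl, -⟩ | ⟨z, hz, rfl, hzx, -⟩
      -- For empty `u` the test compares the empty word with `x`, and the empty word has the least
      -- position.
      · exact not_lt.2 (one_le_position x)
      · simpa using hzx

end Certificate

end Ranking

namespace Ranking

open Function

/-! ### The digits of the rank -/

/-- The queries `(u, x)` for which the digit of the rank of `x` in position `|u|` is `t`. -/
def digitSet (A : Set Word) (t : Bool) : Set Word :=
  {q | (rank A (unpackWord true q)).testBit (unpackWord false q).length = t}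

theorem compl_digitSet (A : Set Word) : (digitSet A true)ᶜ = digitSet A false := by
  ext q
  simp [digitSet]

/-- The bracket of `x` is the unique certificate for either digit value: the verifier checks it and
reads the digit off the rank of its lower end. -/
theorem digitSet_mem_UP {A : Set Word} (hgap : Nongappy A) (hA : SemistrongPRankable A)
    (t : Bool) : digitSet A t ∈ UP := by
  obtain ⟨p, hp⟩ := hgap
  obtain ⟨f, ⟨⟨c, time, out⟩⟩, hf⟩ := hA
  let F : Word → Word := fun x => encodeOptionNat (f x)
  -- The same machine works, since the words `F x` are the encoded values of `f`.
  have hF : FP F := ⟨⟨c, time, out⟩⟩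
  have hFA : ∀ x ∈ A, F x = true :: Computability.encodeNat (rank A x) := fun x hx => by
    simp [F, (hf x).1 hx, encodeOptionNat]
  have hFA' : ∀ x, x ∉ A → F x = [] := fun x hx => by
    simp [F, (hf x).2 hx, encodeOptionNat]
  let d : Word × Word → Bool := fun r =>
    ((lowerRank F (unpackWord false r.2)).drop (unpackWord false r.1).length).headD false
  let V : Word × Word → Bool := fun r =>
    checkBracket F (unpackWord true r.1) r.2 && bif t then d r else !d r
  have hV : FP V := by
    have h₁ : FP fun r : Word × Word => r.1 := .fst .id
    have h₂ : FP fun r : Word × Word => r.2 := .snd .id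
    have hd : FP d := ((h₁.unpackWord false).drop (hF.lowerRank (h₂.unpackWord false))).headD
    exact (hF.checkBracket (h₁.unpackWord true) h₂).and ((FP.const t).cond hd hd.not)
  have hV' : ∀ q w, V (q, w) = true ↔
      q ∈ digitSet A t ∧ ∃ u y, w = packWords u y ∧ IsBracket A (unpackWord true q) u y := by
    intro q w
    rw [Bool.and_eq_true, checkBracket_iff hFA hFA', and_comm]
    refine and_congr_left ?_
    rintro ⟨u, y, rfl, h⟩
    have hd : d (q, packWords u y) =
        (rank A (unpackWord true q)).testBit (unpackWord false q).length := by
      simp only [d, unpackWord_packWords, Bool.false_eq_true, if_false, h.lowerRank_eq hFA]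
      exact headD_drop_encodeNat _ _
    rw [hd]
    cases t <;> simp [digitSet]
  -- Packing doubles lengths; the lower end with its tag has length at most `|x| + 1`, the upper one
  -- at most `p (|x| + 1)`, and `|x| ≤ |q|`.
  refine ⟨V, 2 * (.X + 1) + 2 * p.comp (.X + 1), hV, fun q => ⟨fun hq => ?_, ?_⟩⟩
  -- Asking for length at least `|x| + 1` makes `y` come strictly after `x`.
  · obtain ⟨y, hy, hxy, hyp⟩ := hp ((unpackWord true q).length + 1)
    obtain ⟨u, z, h, hu, hz⟩ := exists_isBracket (position_lt_of_length_lt hxy) hy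
    refine ⟨packWords u z, ⟨?_, (hV' _ _).2 ⟨hq, u, z, rfl, h⟩⟩, ?_⟩
    · have hx := length_unpackWord_le true q
      have := eval_mono p (Nat.add_le_add_right hx 1)
      simp only [length_packWords, Polynomial.eval_add, Polynomial.eval_mul, Polynomial.eval_comp,
        Polynomial.eval_X, Polynomial.eval_one, Polynomial.eval_ofNat] at this ⊢
      lia
    · rintro w ⟨-, hw⟩
      obtain ⟨-, u', z', rfl, h'⟩ := (hV' _ _).1 hw
      obtain ⟨rfl, rfl⟩ := h.unique h'
      rfl
  · rintro hq ⟨w, -, hw⟩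
    exact hq ((hV' _ _).1 hw).1

/-- Extend a binary number by the digit in position `|u| - 1`, found by a query. -/
def digitStep (D : Word → Bool) (s : (Word × Word) × Word) : (Word × Word) × Word :=
  ((s.1.1.tail, bif D (packWords s.1.1.tail s.2) then true :: s.1.2 else
    bif s.1.2.isEmpty then [] else false :: s.1.2), s.2)

theorem FP.digitStep {D : Word → Bool} (hD : FP D) : FP (digitStep D) := by
  have h₁ : FP fun s : (Word × Word) × Word => s.1.1 := .fst (.fst .id)
  have h₂ : FP fun s : (Word × Word) × Word => s.1.2 := .snd (.fst .id)
  have h₃ : FP fun s : (Word × Word) × Word => s.2 := .snd .id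
  exact (h₁.tail.pair ((hD.comp (h₁.tail.packWords h₃)).cond ((FP.const true).cons h₂)
    (h₂.isEmpty.cond (.const []) ((FP.const false).cons h₂)))).pair h₃

/-- Digits are found from the most significant one down: with `|u|` digits to go, the part known is
`r >>> |u|`. A zero digit is not written in front of an empty word, which keeps the representation
canonical. -/
theorem digitStep_iterate {D : Word → Bool} {x : Word} {r : ℕ}
    (hD : ∀ u, D (packWords u x) = r.testBit u.length) (u : Word) :
    ((digitStep D)^[u.length] ((u, Computability.encodeNat (r >>> u.length)), x)).1.2 =
      Computability.encodeNat r := by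
  induction u with
  | nil => rfl
  | cons a u ih =>
    rw [List.length_cons, iterate_succ_apply, ← ih]
    congr 4
    simp only [digitStep, List.tail_cons, hD]
    congr 2
    have h : (r >>> u.length) = Nat.bit (r.testBit u.length) (r >>> (u.length + 1)) := by
      have := (Nat.bit_testBit_zero_shiftRight_one (r >>> u.length)).symm
      rwa [Nat.testBit_shiftRight, Nat.add_zero, ← Nat.shiftRight_add] at this
    rw [h]
    generalize r >>> (u.length + 1) = m
    cases r.testBit u.length
    · by_cases hm : m = 0
      · subst hm; rfl
      · rw [encodeNat_bit _ _ fun h => absurd h hm]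
        have : (Computability.encodeNat m).isEmpty = false := by
          rw [List.isEmpty_eq_false_iff]
          exact fun h => hm (encodeNat_injective h)
        simp [this]
    · rw [encodeNat_bit _ _ fun _ => rfl]
      rfl

theorem strongPRankable_of_digitSet_mem_P {A : Set Word} (h : digitSet A true ∈ P) :
    StrongPRankable A := by
  obtain ⟨D, hD, hDA⟩ := h
  have hD' : ∀ u x, D (packWords u x) = (rank A x).testBit u.length := fun u x => by
    have := hDA (packWords u x)
    rw [digitSet, Set.mem_ofPred_eq, unpackWord_packWords, unpackWord_packWords] at this
    exact Bool.eq_iff_iff.2 this.symm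
  -- The word `true :: x` is a counter for the `|x| + 1` possible digits; only its length matters.
  have hg : FP fun x : Word => ((digitStep D)^[(true :: x).length] ((true :: x, []), x)).1.2 := by
    refine .snd (.fst (.iterate (FP.digitStep hD) ((FP.const true).cons .id)
      ((((FP.const true).cons .id).pair (.const [])).pair .id) ?_))
    rintro ⟨⟨u, r⟩, x⟩
    simp only [digitStep]
    cases D (packWords u.tail x) <;> cases r <;> simp <;> lia
  have hg' : ∀ x : Word, ((digitStep D)^[(true :: x).length] ((true :: x, []), x)).1.2 =
      Computability.encodeNat (rank A x) := by
    intro x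
    have := digitStep_iterate (fun u => hD' u x) (true :: x)
    -- All digits lie below this position, so starting from the empty word is correct.
    have h₀ : rank A x >>> (true :: x).length = 0 :=
      Nat.shiftRight_eq_zero _ _ (by simpa using rank_lt_two_pow x)
    rwa [h₀] at this
  simp only [hg'] at hg
  obtain ⟨⟨c, time, out⟩⟩ := hg
  exact ⟨rank A, ⟨⟨c, time, out⟩⟩, fun _ => rfl⟩

end Ranking

theorem mainTheorem4 (hP : Ranking.P = Ranking.UP ∩ Ranking.coUP) (A : Set Ranking.Word)
    (hgap : Ranking.Nongappy A) (hA : Ranking.SemistrongPRankable A) :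
    Ranking.StrongPRankable A := by
  refine Ranking.strongPRankable_of_digitSet_mem_P ?_
  rw [hP]
  refine ⟨Ranking.digitSet_mem_UP hgap hA true, ?_⟩
  rw [Ranking.coUP, Set.mem_ofPred_eq, Ranking.compl_digitSet]
  exact Ranking.digitSet_mem_UP hgap hA false
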